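/- Let $U\subseteq\mathbb R^m$ be open, let $V:U\to\mathbb R$ be $C^\infty$, and consider the Hamiltonian system $\dot{x}=p$, $\dot{p}=-\nabla V(x)$ with $H=\tfrac12 |p|^2+V(x)$. Let $\bar\nabla V(x,y)\in\mathbb R^m$ be a symmetric discrete gradient of $V$: a $C^\infty$ function on an open symmetric set $W\subseteq U\times U$ containing the diagonal of $U \times U$, with $\bar\nabla V(x,y)\cdot(y-x)=V(y)-V(x)$, $\bar\nabla V(x,y)=\bar\nabla V(y,x)$ on $W$, and $\bar\nabla V(y,y')\to\nabla V(x)$ as $y,y'\to x\in U$. Let $B_{\gamma\mu\nu}(x)$, symmetric in $\mu,\nu$, be the coefficients of the quadratic term in the Taylor expansion (summation over repeated indices) $$\bar\nabla_\gamma V(x,x+\Delta)=V_{,\gamma}+\tfrac12 A_{\gamma\mu}\Delta^\mu+\tfrac1{3!}B_{\gamma\mu\nu}\Delta^\mu\Delta^\nu+O(|\Delta|^3),\qquad \Delta\to0,$$ where indices after a comma denote partial derivatives of $V$ at $x$. The locally exact modification (LEX) of the discrete gradient scheme is the one-step method $(x_n,p_n)\mapsto(x_{n+1},p_{n+1})$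 with step $h>0$ given by $$\delta_n^{-1}(x_{n+1}-x_n)=\tfrac12(p_n+p_{n+1}),\qquad (\delta_n^{T})^{-1}(p_{n+1}-p_n)=-\bar\nabla V(x_n,x_{n+1}),$$ $$\delta_n=h\,\operatorname{tanc}\frac{h\Omega_n}{2},\qquad \Omega_n^2=V_{xx}(x_n),\qquad \operatorname{tanc}z=\frac{\tan z}{z},\ \operatorname{tanc}0=1,$$ where $V_{xx}$ is the Hessian matrix of $V$; $\operatorname{tanc}$ is even, so $\delta_n$ is a function of the symmetric matrix $V_{xx}(x_n)$. The method has order at least $r$ if, for every $(x_n,p_n)\in U\times\mathbb R^m$ and all sufficiently small $h>0$, these equations have exactly one solution $(x_{n+1},p_{n+1})$ in some fixed ($h$-independent) neighbourhood of $(x_n,p_n)$, and this solution differs from the exact solution of the Hamiltonian system with initial value $(x_n,p_n)$ at time $h$ by $O(h^{r+1})$ as $h\to0$. **Theorem.** The LEX modification has order - at least $2$ (always); - at least $3$ if and only if $B_{\gamma\mu\nu}=V_{,\gamma\mu\nu}$ for all $\gamma,\mu,\nu$ everywhere on $U$; - at least $4$ if and only if $B_{\gamma\mu\nu}=V_{,\gamma\mu\nu}=0$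 for all $\gamma,\mu,\nu$ everywhere on $U$. -/

import Mathlib

open scoped ContDiff Topology

noncomputable section

namespace LEXScheme

/-- The configuration (and momentum) space `ℝᵐ` with its Euclidean norm and inner product. -/
abbrev Space (m : ℕ) : Type := EuclideanSpace ℝ (Fin m)

/-- The partial derivative `∂f/∂x^γ` at `x`. -/
def pd {m : ℕ} (f : Space m → ℝ) (γ : Fin m) (x : Space m) : ℝ :=
  fderiv ℝ f x (EuclideanSpace.single γ 1)

/-- The Hessian matrix `V_{xx} = (V,_{γμ})` at `x`. -/
def hess {m : ℕ} (V : Space m → ℝ) (x : Space m) : Matrix (Fin m) (Fin m) ℝ :=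
  Matrix.of fun γ μ => pd (pd V γ) μ x

/-- The third partial derivative `V,_{γμν}` at `x`. -/
def third {m : ℕ} (V : Space m → ℝ) (γ μ ν : Fin m) (x : Space m) : ℝ :=
  pd (pd (pd V γ) μ) ν x

/-- `g` is a smooth symmetric discrete gradient of the potential `V` on the open set `U`.  It is
defined on an open symmetric neighbourhood `W` of the diagonal of `U × U` (all of `U × U` is
allowed, but, e.g., the average of `∇V` over the segment from `x` to `y` is only defined when that
segment stays in `U`). -/
structure IsSymmetricDiscreteGradient {m : ℕ} (V : Space m → ℝ) (U : Set (Space m))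
    (W : Set (Space m × Space m)) (g : Space m → Space m → Space m) : Prop where
  isOpen : IsOpen W
  subset : W ⊆ U ×ˢ U
  diag_mem : ∀ x ∈ U, (x, x) ∈ W
  swap_mem : ∀ x y, (x, y) ∈ W → (y, x) ∈ W
  smooth : ContDiffOn ℝ ∞ (fun z : Space m × Space m => g z.1 z.2) W
  /-- `∇̄V(x, y) · (y - x) = V(y) - V(x)`. -/
  inner_eq : ∀ x y, (x, y) ∈ W → inner ℝ (g x y) (y - x) = V y - V x
  /-- `∇̄V(y, y') → ∇V(x)` as `y, y' → x`. -/
  tendsto : ∀ x ∈ U, Filter.Tendsto (fun z : Space m × Space m => g z.1 z.2) (𝓝 (x, x))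
    (𝓝 (gradient V x))
  symm : ∀ x y, (x, y) ∈ W → g x y = g y x

/-- The coefficient `B_{γμν}(x)`, symmetric in `μ, ν`, of the Taylor expansion
`∇̄_γ V(x, x + Δ) = V,_γ + (1/2) A_{γμ} Δ^μ + (1/3!) B_{γμν} Δ^μ Δ^ν + …` in powers of `Δ`.
Since the quadratic term is also `(1/2) ∂_μ ∂_ν ∇̄_γ V(x, ·)(x) Δ^μ Δ^ν`, it is
`3 ∂_μ ∂_ν ∇̄_γ V(x, ·)(x)`. -/
def coeffB {m : ℕ} (g : Space m → Space m → Space m) (γ μ ν : Fin m) (x : Space m) : ℝ :=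
  3 * pd (pd (fun y => g x y γ) μ) ν x

/-- The even function `tanc z = tan z / z`, `tanc 0 = 1`, expressed through `s = z²`:
for `s < 0` one has `z = i √(-s)` and `tan z / z = tanh √(-s) / √(-s)`. -/
def tancSqrt (s : ℝ) : ℝ :=
  if 0 < s then Real.tan (√s) / √s
  else if s = 0 then 1
  else Real.tanh (√(-s)) / √(-s)

/-- `δ = h tanc (h Ω / 2)` with `Ω² = V_{xx}(x)`, a function of the symmetric matrix `V_{xx}(x)`:
it has the same eigenvectors as `V_{xx}(x)`, and an eigenvalue `s` is replaced by
`h tanc (h √s / 2)`. -/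
def deltaLEX {m : ℕ} (V : Space m → ℝ) (h : ℝ) (x : Space m) : Matrix (Fin m) (Fin m) ℝ :=
  h • cfc (fun s : ℝ => tancSqrt (h ^ 2 / 4 * s)) (hess V x)

/-- `(x', p')` is obtained from `(x, p)` by one step of size `h` of the LEX scheme
`δ⁻¹ (x' - x) = (p + p') / 2`, `(δᵀ)⁻¹ (p' - p) = - ∇̄V(x, x')`, where `δ` is evaluated at `x`.
The matrix `δ` is required to be invertible, and the equations are multiplied by `δ`, `δᵀ`. -/
def IsStep {m : ℕ} (V : Space m → ℝ) (W : Set (Space m × Space m))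
    (g : Space m → Space m → Space m) (h : ℝ) (x p x' p' : Space m) : Prop :=
  (x, x') ∈ W ∧ IsUnit (deltaLEX V h x) ∧
  x' - x = Matrix.toEuclideanLin (deltaLEX V h x) ((1 / 2 : ℝ) • (p + p')) ∧
  p' - p = - Matrix.toEuclideanLin (deltaLEX V h x).transpose (g x x')

/-- `(ξ, η)` solves `ẋ = p`, `ṗ = -∇V(x)` on `(-ε, ε)` with `(ξ(0), η(0)) = (x, p)`. -/
def IsExactSolution {m : ℕ} (V : Space m → ℝ) (U : Set (Space m)) (x p : Space m) (ε : ℝ)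
    (ξ η : ℝ → Space m) : Prop :=
  ξ 0 = x ∧ η 0 = p ∧ ∀ t ∈ Set.Ioo (-ε) ε,
    ξ t ∈ U ∧ HasDerivAt ξ (η t) t ∧ HasDerivAt η (-gradient V (ξ t)) t

/-- The LEX scheme has order at least `r`: for every starting point `(x, p)` and all sufficiently
small steps `h > 0`, the implicit equations of the scheme have exactly one solution near `(x, p)`,
and it differs from the exact solution at time `h` by `O(h^(r+1))`. -/
def HasOrderAtLeast {m : ℕ} (V : Space m → ℝ) (U : Set (Space m)) (W : Set (Space m × Space m))
    (g : Space m → Space m → Space m) (r : ℕ) : Prop :=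
  ∀ x ∈ U, ∀ p : Space m, ∃ ε > 0, ∃ ρ > 0, ∃ K : ℝ, ∃ ξ η : ℝ → Space m,
    IsExactSolution V U x p ε ξ η ∧
    ∀ h ∈ Set.Ioo 0 ε,
      (∃! z : Space m × Space m, z ∈ Metric.ball (x, p) ρ ∧ IsStep V W g h x p z.1 z.2) ∧
      ∀ z ∈ Metric.ball (x, p) ρ, IsStep V W g h x p z.1 z.2 →
        ‖z.1 - ξ h‖ ≤ K * h ^ (r + 1) ∧ ‖z.2 - η h‖ ≤ K * h ^ (r + 1)

end LEXScheme

end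

/-!
Put `a = ∇V(x)`, `Q = V_{xx}(x)`, `S = D²(∇V)(x)`, and let `B` be three times the second derivative
of `y ↦ ∇̄V(x, y)` at `y = x`.  The symmetry of the discrete gradient forces its linear term to be
half of that of `∇V`:

  `∇V(x + d) = a + Q d + S(d, d) / 2 + O(|d|³)`,
  `∇̄V(x, x + d) = a + Q d / 2 + B(d, d) / 6 + O(|d|³)`

(`taylor_two_isBigO`, `symmetric_taylor_two_isBigO`), while `δ = h + h³ Q / 12 + O(h⁵)`
(`deltaCLM_isBigO`), since `tanc √s = 1 + s / 3 + O(s²)`.  Expanding both the scheme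
(`numerical_expansion`) and the Hamiltonian system (`exact_expansion`) in powers of `h`, all terms
containing only `a`, `p`, `Q` agree, and the local error (`local_error_isBigO`) is

  position: `h⁴ / 24 (S(p, p) - 2 B(p, p)) + O(h⁵)`,
  momentum: `h³ / 6 (S(p, p) - B(p, p)) + O(h⁴)`.

Hence the order is at least `2`; it is at least `3` exactly if `B(p, p) = S(p, p)` for all `p`, that
is `B = S` by polarization; and order `4` forces in addition `S = 2 B`, that is `B = S = 0`.

If conversely `B = S = 0` on all of `U`, the momentum error has to be controlled to `O(h⁵)`, which
needs `∇̄V(x, x + d) = a + Q d / 2 + O(|d|⁴)` (`symmetric_taylor_one_isBigO_of_flat`).  The cubic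
term is excluded by expanding around the midpoint `z = (x + d/2, x + d/2)` in the direction
`w = (-d/2, d/2)`: by symmetry `∇̄V` takes the same value at `z + w` and `z - w`, so that terms of
odd order cancel, and the quadratic term vanishes because, by the parallelogram law, `D²∇̄V(y, y)` on an
antidiagonal vector `(-d, d)` is a combination of `B` and `S` (`fderiv_fderiv_antidiag`).

The implicit equations are solved by a contraction argument, as `δ = O(h)`.
-/

namespace LEXScheme

open Asymptotics Filter Set

/-! ### Taylor estimates in one variable, `tanc`, and uniform Taylor expansion -/

theorem pow_isBigO_pow_nhds_zero {j k : ℕ} (h : k ≤ j) :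
    (fun t : ℝ => t ^ j) =O[𝓝 0] fun t => t ^ k := by
  rcases h.eq_or_lt with rfl | h
  · exact isBigO_refl _ _
  · exact (isLittleO_pow_pow h).isBigO

/-- Integrating a bound `O(tᵏ)`, with vanishing initial value. -/
theorem isBigO_pow_succ_of_hasDerivAt {F : Type*} [NormedAddCommGroup F] [NormedSpace ℝ F]
    {u u' : ℝ → F} {k : ℕ} (hu : ∀ᶠ t in 𝓝 0, HasDerivAt u (u' t) t) (h0 : u 0 = 0)
    (h : u' =O[𝓝 0] fun t => t ^ k) : u =O[𝓝 0] fun t => t ^ (k + 1) := by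
  obtain ⟨C, hC, hb⟩ := h.exists_pos
  obtain ⟨ε, hε, hball⟩ := Metric.eventually_nhds_iff_ball.1 (hu.and hb.bound)
  refine IsBigO.of_bound C (Metric.eventually_nhds_iff_ball.2 ⟨ε, hε, fun t ht => ?_⟩)
  have hsub : ∀ s ∈ Metric.closedBall (0 : ℝ) |t|, s ∈ Metric.ball (0 : ℝ) ε := fun s hs => by
    simp only [Metric.mem_closedBall, Metric.mem_ball, dist_zero_right, Real.norm_eq_abs] at *
    exact hs.trans_lt ht
  have key := (convex_closedBall (0 : ℝ) |t|).norm_image_sub_le_of_norm_hasDerivWithin_le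
    (f := u) (f' := u') (C := C * |t| ^ k) (x := 0) (y := t)
    (fun s hs => (hball s (hsub s hs)).1.hasDerivWithinAt)
    (fun s hs => by
      refine (hball s (hsub s hs)).2.trans ?_
      simp only [Metric.mem_closedBall, dist_zero_right, Real.norm_eq_abs] at hs
      rw [norm_pow, Real.norm_eq_abs]
      gcongr)
    (by simp) (by simp)
  simpa [h0, norm_pow, pow_succ, mul_assoc] using key

/-- The Riccati equation `u' = 1 + c u²` is solved by `tan` for `c = 1` and by `tanh` for
`c = -1`; this is the common beginning of their power series. -/
theorem isBigO_sub_cubic_of_riccati {u : ℝ → ℝ} {c : ℝ} (h0 : u 0 = 0)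
    (hu : ∀ᶠ t in 𝓝 0, HasDerivAt u (1 + c * u t ^ 2) t) :
    (fun t => u t - t - c / 3 * t ^ 3) =O[𝓝 0] fun t => t ^ 5 := by
  have h1 : u =O[𝓝 0] fun t : ℝ => t := by
    simpa [h0] using hu.self_of_nhds.isBigO_sub
  -- `u' - 1 = c u² = O(t²)`, and then `(u - t - c t³/3)' = c (u² - t²)`
  have hlin : (fun t => u t - t) =O[𝓝 0] fun t => t ^ 3 := by
    refine isBigO_pow_succ_of_hasDerivAt (k := 2) (u' := fun t => c * u t ^ 2) ?_ (by simp [h0])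
      ((h1.pow 2).const_mul_left c)
    filter_upwards [hu] with t ht
    exact (ht.sub (hasDerivAt_id t)).congr_deriv (by ring)
  refine isBigO_pow_succ_of_hasDerivAt (k := 4) (u' := fun t => c * ((u t - t) * (u t + t))) ?_
    (by simp [h0]) ?_
  · filter_upwards [hu] with t ht
    exact ((ht.sub (hasDerivAt_id t)).sub ((hasDerivAt_pow 3 t).const_mul (c / 3))).congr_deriv
      (by push_cast; ring)
  · refine IsBigO.const_mul_left ?_ c
    exact (hlin.mul (h1.add (isBigO_refl _ _))).congr_right fun t => by ring

theorem tancSqrt_isBigO : (fun s => tancSqrt s - 1 - s / 3) =O[𝓝 0] fun s => s ^ 2 := by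
  have htan : (fun t => Real.tan t - t - 1 / 3 * t ^ 3) =O[𝓝 0] fun t : ℝ => t ^ 5 := by
    refine isBigO_sub_cubic_of_riccati Real.tan_zero ?_
    have hc : ∀ᶠ t in 𝓝 (0 : ℝ), Real.cos t ≠ 0 :=
      Real.continuous_cos.continuousAt.eventually_ne (by simp)
    filter_upwards [hc] with t ht
    refine (Real.hasDerivAt_tan ht).congr_deriv ?_
    rw [Real.tan_eq_sin_div_cos]
    field_simp
    linarith [Real.sin_sq_add_cos_sq t]
  have htanh : (fun t => Real.tanh t - t - (-1) / 3 * t ^ 3) =O[𝓝 0] fun t : ℝ => t ^ 5 := by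
    refine isBigO_sub_cubic_of_riccati Real.tanh_zero (Eventually.of_forall fun t => ?_)
    have hc : Real.cosh t ≠ 0 := (Real.cosh_pos t).ne'
    have : Real.tanh = fun t => Real.sinh t / Real.cosh t := funext Real.tanh_eq_sinh_div_cosh
    rw [this]
    refine ((Real.hasDerivAt_sinh t).div (Real.hasDerivAt_cosh t) hc).congr_deriv ?_
    field_simp
    ring
  obtain ⟨C₁, hC₁, h₁⟩ := htan.exists_pos
  obtain ⟨C₂, hC₂, h₂⟩ := htanh.exists_pos
  have habs : Tendsto (fun s : ℝ => √|s|) (𝓝 0) (𝓝 0) := by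
    have : Continuous fun s : ℝ => √|s| := by fun_prop
    simpa using this.tendsto 0
  refine IsBigO.of_bound (max C₁ C₂) ?_
  filter_upwards [habs.eventually h₁.bound, habs.eventually h₂.bound] with s hs₁ hs₂
  rcases lt_trichotomy s 0 with hs | rfl | hs
  · obtain ⟨t, ht, rfl⟩ : ∃ t : ℝ, 0 < t ∧ s = -t ^ 2 :=
      ⟨√(-s), by simpa using hs, by rw [Real.sq_sqrt (by linarith)]; ring⟩
    have e : tancSqrt (-t ^ 2) - 1 - -t ^ 2 / 3 = (Real.tanh t - t - -1 / 3 * t ^ 3) / t := by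
      rw [tancSqrt, if_neg hs.not_gt, if_neg hs.ne, neg_neg, Real.sqrt_sq ht.le]
      field_simp
    simp only [abs_neg, abs_pow, abs_of_pos ht, Real.sqrt_sq ht.le] at hs₂
    rw [e, norm_div, Real.norm_of_nonneg ht.le, div_le_iff₀ ht]
    refine hs₂.trans ?_
    rw [Real.norm_of_nonneg (by positivity), Real.norm_of_nonneg (by positivity), mul_assoc]
    have : (-t ^ 2) ^ 2 * t = t ^ 5 := by ring
    rw [this]
    gcongr
    exact le_max_right _ _
  · simp [tancSqrt]
  · obtain ⟨t, ht, rfl⟩ : ∃ t : ℝ, 0 < t ∧ s = t ^ 2 :=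
      ⟨√s, by simpa using hs, by rw [Real.sq_sqrt hs.le]⟩
    have e : tancSqrt (t ^ 2) - 1 - t ^ 2 / 3 = (Real.tan t - t - 1 / 3 * t ^ 3) / t := by
      rw [tancSqrt, if_pos hs, Real.sqrt_sq ht.le]
      field_simp
    simp only [abs_pow, abs_of_pos ht, Real.sqrt_sq ht.le] at hs₁
    rw [e, norm_div, Real.norm_of_nonneg ht.le, div_le_iff₀ ht]
    refine hs₁.trans ?_
    rw [Real.norm_of_nonneg (by positivity), Real.norm_of_nonneg (by positivity), mul_assoc]
    have : (t ^ 2) ^ 2 * t = t ^ 5 := by ring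
    rw [this]
    gcongr
    exact le_max_left _ _

/-- Taylor's formula, with a remainder that is uniform in the base point. -/
theorem taylor_isBigO_uniform {X Y : Type*} [NormedAddCommGroup X] [NormedSpace ℝ X]
    [NormedAddCommGroup Y] [NormedSpace ℝ Y] [CompleteSpace Y] {G : X → Y} {z₀ : X} (n : ℕ)
    (hG : ContDiffAt ℝ ∞ G z₀) :
    (fun q : X × X => G (q.1 + q.2) -
        ∑ k ∈ Finset.range (n + 1), (k.factorial : ℝ)⁻¹ • iteratedFDeriv ℝ k G q.1 fun _ => q.2)
      =O[𝓝 (z₀, 0)] fun q => ‖q.2‖ ^ (n + 1) := by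
  have hsm : ∀ᶠ z in 𝓝 z₀, ContDiffAt ℝ (n + 1) G z :=
    (hG.of_le (by exact_mod_cast le_top)).eventually (by exact_mod_cast (by simp))
  have hcont : ContinuousAt (iteratedFDeriv ℝ (n + 1) G) z₀ := by
    refine (ContDiffAt.iteratedFDeriv_right (m := 0) (i := n + 1) hG ?_).continuousAt
    exact_mod_cast le_top
  have hbd : ∀ᶠ z in 𝓝 z₀, ‖iteratedFDeriv ℝ (n + 1) G z‖ ≤ ‖iteratedFDeriv ℝ (n + 1) G z₀‖ + 1 :=
    hcont.norm.eventually_le_const (by linarith)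
  obtain ⟨r, hr, hball⟩ := Metric.eventually_nhds_iff_ball.1 (hsm.and hbd)
  set M := ‖iteratedFDeriv ℝ (n + 1) G z₀‖ + 1
  refine IsBigO.of_bound ((n.factorial : ℝ)⁻¹ * M) ?_
  have h1 : ∀ᶠ q : X × X in 𝓝 (z₀, 0), q.1 ∈ Metric.ball z₀ r :=
    continuous_fst.continuousAt (Metric.ball_mem_nhds _ hr)
  have h2 : ∀ᶠ q : X × X in 𝓝 (z₀, 0), q.1 + q.2 ∈ Metric.ball z₀ r := by
    have : ContinuousAt (fun q : X × X => q.1 + q.2) (z₀, 0) := by fun_prop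
    exact this (by simpa using Metric.ball_mem_nhds z₀ hr)
  filter_upwards [h1, h2] with q hq1 hq2
  have hseg : ∀ t ∈ Icc (0 : ℝ) 1, q.1 + t • q.2 ∈ Metric.ball z₀ r := fun t ht =>
    (convex_ball z₀ r).add_smul_mem hq1 hq2 ht
  rw [map_add_eq_sum_add_integral_iteratedFDeriv fun t ht => (hball _ (hseg t ht)).1,
    add_sub_cancel_left, norm_smul, Real.norm_of_nonneg (by positivity), mul_assoc]
  gcongr
  refine (intervalIntegral.norm_integral_le_of_norm_le_const (C := M * ‖q.2‖ ^ (n + 1))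
    fun t ht => ?_).trans (by simp)
  rw [uIoc_of_le zero_le_one] at ht
  have ht' : t ∈ Icc (0 : ℝ) 1 := ⟨ht.1.le, ht.2⟩
  have hpow : ‖(1 - t) ^ n‖ ≤ 1 := by
    rw [norm_pow, Real.norm_of_nonneg (by linarith [ht.2])]
    exact pow_le_one₀ (by linarith [ht.2]) (by linarith [ht.1])
  rw [norm_smul]
  calc _ ≤ 1 * (‖iteratedFDeriv ℝ (n + 1) G (q.1 + t • q.2)‖ * ∏ _i : Fin (n + 1), ‖q.2‖) := by
        gcongr
        exact ContinuousMultilinearMap.le_opNorm _ _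
    _ ≤ _ := by
        rw [one_mul, Finset.prod_const, Finset.card_univ, Fintype.card_fin]
        gcongr
        exact (hball _ (hseg t ht')).2

/-! ### The matrix `δ` -/

open scoped Matrix.Norms.L2Operator in
/-- To compare a function of a symmetric matrix with the affine function `1 + c s`, it suffices to
compare them on the eigenvalues. -/
theorem norm_cfc_sub_one_sub_smul_le {n : Type*} [Fintype n] [DecidableEq n]
    {A : Matrix n n ℝ} (hA : A.IsHermitian) (f : ℝ → ℝ) (c M : ℝ) (hM : 0 ≤ M)
    (h : ∀ i, |f (hA.eigenvalues i) - 1 - c * hA.eigenvalues i| ≤ M) :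
    ‖cfc f A - 1 - c • A‖ ≤ M := by
  have key : cfc f A - 1 - c • A = Unitary.conjStarAlgAut ℝ _ hA.eigenvectorUnitary
      (Matrix.diagonal fun i => f (hA.eigenvalues i) - 1 - c * hA.eigenvalues i) := by
    have e : (Matrix.diagonal fun i => f (hA.eigenvalues i) - 1 - c * hA.eigenvalues i) =
        Matrix.diagonal (RCLike.ofReal ∘ f ∘ hA.eigenvalues) - 1 -
          c • Matrix.diagonal ((RCLike.ofReal : ℝ → ℝ) ∘ hA.eigenvalues) := by
      rw [← Matrix.diagonal_one, ← Matrix.diagonal_smul, Matrix.diagonal_sub, Matrix.diagonal_sub]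
      rfl
    rw [e, map_sub, map_sub, map_one, map_smul, ← hA.spectral_theorem, hA.cfc_eq]
    rfl
  rw [key, Unitary.conjStarAlgAut_apply, ← Unitary.coe_star, CStarRing.norm_mul_coe_unitary,
    CStarRing.norm_coe_unitary_mul, Matrix.l2_opNorm_diagonal]
  exact (pi_norm_le_iff_of_nonneg hM).2 h

variable {m : ℕ}

theorem deltaLEX_transpose (V : Space m → ℝ) (h : ℝ) (x : Space m) :
    (deltaLEX V h x).transpose = deltaLEX V h x := by
  have : IsSelfAdjoint (cfc (fun s : ℝ => tancSqrt (h ^ 2 / 4 * s)) (hess V x)) :=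
    cfc_predicate _ _
  rw [deltaLEX, Matrix.transpose_smul]
  exact congrArg (h • ·) this

/-- The operator on `ℝᵐ` with matrix `δ`. -/
noncomputable def deltaCLM (V : Space m → ℝ) (h : ℝ) (x : Space m) : Space m →L[ℝ] Space m :=
  Matrix.toEuclideanCLM (n := Fin m) (𝕜 := ℝ) (deltaLEX V h x)

/-- The operator on `ℝᵐ` whose matrix is the Hessian of `V`. -/
noncomputable def hessCLM (V : Space m → ℝ) (x : Space m) : Space m →L[ℝ] Space m :=
  Matrix.toEuclideanCLM (n := Fin m) (𝕜 := ℝ) (hess V x)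

/-- `δ = h + h³ V_{xx} / 12 + O(h⁵)`. -/
theorem deltaCLM_isBigO {V : Space m → ℝ} {x : Space m} (hH : (hess V x).IsHermitian) :
    (fun h : ℝ => deltaCLM V h x - h • ContinuousLinearMap.id ℝ (Space m) -
      (h ^ 3 / 12) • hessCLM V x) =O[𝓝 0] fun h => h ^ 5 := by
  obtain ⟨C, hC, hb⟩ := tancSqrt_isBigO.exists_pos
  set L : ℝ := ∑ i, |hH.eigenvalues i| with hL
  have hL0 : 0 ≤ L := Finset.sum_nonneg fun i _ => abs_nonneg _
  have hev : ∀ᶠ h : ℝ in 𝓝 0, ∀ i, ‖tancSqrt (h ^ 2 / 4 * hH.eigenvalues i) - 1 -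
      h ^ 2 / 4 * hH.eigenvalues i / 3‖ ≤ C * ‖(h ^ 2 / 4 * hH.eigenvalues i) ^ 2‖ := by
    refine eventually_all.2 fun i => ?_
    have : Tendsto (fun h : ℝ => h ^ 2 / 4 * hH.eigenvalues i) (𝓝 0) (𝓝 0) := by
      have : Continuous fun h : ℝ => h ^ 2 / 4 * hH.eigenvalues i := by fun_prop
      simpa using this.tendsto 0
    exact this.eventually hb.bound
  refine IsBigO.of_bound (C * L ^ 2) ?_
  filter_upwards [hev] with h hh
  have e : deltaCLM V h x - h • ContinuousLinearMap.id ℝ (Space m) - (h ^ 3 / 12) • hessCLM V x =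
      h • Matrix.toEuclideanCLM (n := Fin m) (𝕜 := ℝ)
        (cfc (fun s : ℝ => tancSqrt (h ^ 2 / 4 * s)) (hess V x) - 1 -
          (h ^ 2 / 12) • hess V x) := by
    rw [map_sub, map_sub, map_one, map_smul, deltaCLM, deltaLEX, map_smul, hessCLM, smul_sub,
      smul_sub, smul_smul]
    congr 2
    ring
  rw [e, norm_smul, norm_pow, ← norm_pow]
  have hbd := norm_cfc_sub_one_sub_smul_le hH (fun s : ℝ => tancSqrt (h ^ 2 / 4 * s)) (h ^ 2 / 12)
    (C * L ^ 2 * h ^ 4) (by positivity) fun i => by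
      have h1 := hh i
      have h2 : |hH.eigenvalues i| ≤ L :=
        Finset.single_le_sum (f := fun i => |hH.eigenvalues i|) (fun i _ => abs_nonneg _)
          (Finset.mem_univ i)
      have h3 : hH.eigenvalues i ^ 2 ≤ L ^ 2 := by
        rw [← sq_abs]
        gcongr
      rw [Real.norm_eq_abs, Real.norm_of_nonneg (by positivity)] at h1
      calc _ = |tancSqrt (h ^ 2 / 4 * hH.eigenvalues i) - 1 -
              h ^ 2 / 4 * hH.eigenvalues i / 3| := by congr 1; ring
        _ ≤ C * (h ^ 2 / 4 * hH.eigenvalues i) ^ 2 := h1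
        _ = C * (hH.eigenvalues i ^ 2 * h ^ 4 / 16) := by ring
        _ ≤ C * (L ^ 2 * h ^ 4 / 1) := by gcongr; norm_num
        _ = _ := by ring
  rw [← Matrix.l2_opNorm_toEuclideanCLM] at hbd
  calc _ ≤ ‖h‖ * (C * L ^ 2 * h ^ 4) := by gcongr
    _ = _ := by
      rw [norm_pow, Real.norm_eq_abs, pow_succ |h| 4, ← abs_pow, abs_of_nonneg (by positivity :
        0 ≤ h ^ 4)]
      ring

theorem eventually_isUnit_deltaLEX {V : Space m → ℝ} {x : Space m} (hH : (hess V x).IsHermitian) :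
    ∀ᶠ h : ℝ in 𝓝[>] 0, IsUnit (deltaLEX V h x) := by
  have hO : (fun h : ℝ => deltaCLM V h x - h • (1 : Space m →L[ℝ] Space m)) =O[𝓝 0]
      fun h => h ^ 3 := by
    have h1 : (fun h : ℝ => (h ^ 3 / 12) • hessCLM V x) =O[𝓝 0] fun h => h ^ 3 :=
      IsBigO.of_bound (‖hessCLM V x‖ / 12) (Eventually.of_forall fun h => by
        rw [norm_smul, norm_div, Real.norm_of_nonneg (by norm_num : (0 : ℝ) ≤ 12)]
        exact le_of_eq (by ring))
    have h2 : (fun h : ℝ => h ^ 5) =O[𝓝 0] fun h : ℝ => h ^ 3 :=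
      pow_isBigO_pow_nhds_zero (by norm_num)
    refine (((deltaCLM_isBigO hH).trans h2).add h1).congr_left fun h => ?_
    rw [sub_add_cancel]
    rfl
  have ho : (fun h : ℝ => deltaCLM V h x - h • (1 : Space m →L[ℝ] Space m)) =o[𝓝 0]
      fun h => h := by
    refine hO.trans_isLittleO ?_
    simpa using isLittleO_pow_pow (𝕜 := ℝ) (m := 1) (n := 3) (by norm_num)
  filter_upwards [nhdsWithin_le_nhds (ho.bound (c := 1 / 2) (by norm_num)), self_mem_nhdsWithin]
    with h hh (hpos : 0 < h)
  have hu : IsUnit (h⁻¹ • deltaCLM V h x) := by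
    have hlt : ‖1 - h⁻¹ • deltaCLM V h x‖ < 1 := by
      have : 1 - h⁻¹ • deltaCLM V h x =
          -(h⁻¹ • (deltaCLM V h x - h • (1 : Space m →L[ℝ] Space m))) := by
        rw [smul_sub, smul_smul, inv_mul_cancel₀ hpos.ne', one_smul, neg_sub]
      rw [this, norm_neg, norm_smul, norm_inv, inv_mul_lt_iff₀ (by simpa using hpos.ne')]
      have : 0 < ‖h‖ := by simpa using hpos.ne'
      linarith
    simpa using (Units.oneSub _ hlt).isUnit
  have hu' : IsUnit (deltaCLM V h x) := by
    have h0 : deltaCLM V h x = algebraMap ℝ (Space m →L[ℝ] Space m) h * h⁻¹ • deltaCLM V h x := by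
      rw [← Algebra.smul_def, smul_smul, mul_inv_cancel₀ hpos.ne', one_smul]
    rw [h0]
    exact ((isUnit_iff_ne_zero.2 hpos.ne').map _).mul hu
  exact (MulEquiv.isUnit_map (Matrix.toEuclideanCLM (n := Fin m) (𝕜 := ℝ))).1 hu'

theorem isStep_iff {V : Space m → ℝ} {W : Set (Space m × Space m)} {g : Space m → Space m → Space m}
    {h : ℝ} {x p x' p' : Space m} :
    IsStep V W g h x p x' p' ↔ (x, x') ∈ W ∧ IsUnit (deltaLEX V h x) ∧
      x' - x = deltaCLM V h x ((1 / 2 : ℝ) • (p + p')) ∧ p' - p = -deltaCLM V h x (g x x') := by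
  rw [IsStep, deltaLEX_transpose]
  rfl

/-! ### Local expansions of the numerical and of the exact solution -/

section Orders

theorem isBigO_pow_mono {E : Type*} [NormedAddCommGroup E] {l : Filter ℝ} (hl : l ≤ 𝓝 0)
    {u : ℝ → E} {j k : ℕ} (hu : u =O[l] fun h => h ^ j)
    (hjk : k ≤ j) : u =O[l] fun h => h ^ k :=
  hu.trans ((pow_isBigO_pow_nhds_zero hjk).mono hl)

theorem isBigO_const_pow_zero {E : Type*} [NormedAddCommGroup E] {l : Filter ℝ} (v : E) :
    (fun _ : ℝ => v) =O[l] fun h => h ^ 0 := by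
  simpa using isBigO_const_const v (one_ne_zero (α := ℝ)) l

variable {E F : Type*} [NormedAddCommGroup E] [NormedSpace ℝ E] [NormedAddCommGroup F]
  [NormedSpace ℝ F] {l : Filter ℝ}

theorem isBigO_clm_apply {A : ℝ → E →L[ℝ] F} {u : ℝ → E} {i j : ℕ}
    (hA : A =O[l] fun h => h ^ i) (hu : u =O[l] fun h => h ^ j) :
    (fun h => A h (u h)) =O[l] fun h => h ^ (i + j) := by
  refine (IsBigO.trans (IsBigO.of_bound 1 (Eventually.of_forall fun h => ?_))
    (hA.norm_left.mul hu.norm_left)).congr_right fun h => (pow_add h i j).symm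
  simpa using (A h).le_opNorm (u h)

theorem isBigO_mul_pow_smul {u : ℝ → E} {j : ℕ} (c : ℝ) (i : ℕ) (hu : u =O[l] fun h => h ^ j) :
    (fun h => (c * h ^ i) • u h) =O[l] fun h => h ^ (i + j) :=
  (((isBigO_refl (fun h : ℝ => h ^ i) l).const_mul_left c).smul hu).congr_right fun h => by
    rw [smul_eq_mul, pow_add]

theorem isBigO_clm_comp (L : E →L[ℝ] F) {u : ℝ → E} {j : ℕ} (hu : u =O[l] fun h => h ^ j) :
    (fun h => L (u h)) =O[l] fun h => h ^ j :=
  (L.isBigO_comp u l).trans hu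

theorem isBigO_bilin {B : E →L[ℝ] E →L[ℝ] F} {u v : ℝ → E} {i j : ℕ}
    (hu : u =O[l] fun h => h ^ i) (hv : v =O[l] fun h => h ^ j) :
    (fun h => B (u h) (v h)) =O[l] fun h => h ^ (i + j) :=
  isBigO_clm_apply (isBigO_clm_comp B hu) hv

end Orders

section Numerical

variable {E : Type*} [NormedAddCommGroup E] [NormedSpace ℝ E] {l : Filter ℝ}
  {D : ℝ → E →L[ℝ] E} {Q : E →L[ℝ] E} {X P G : ℝ → E} {x p a : E}

theorem isBigO_one_of_delta_expansion (hl : l ≤ 𝓝 0)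
    (hD : (fun h => D h - h • ContinuousLinearMap.id ℝ E - (h ^ 3 / 12) • Q) =O[l]
      fun h => h ^ 5) : D =O[l] fun h => h ^ 1 := by
  have h1 := isBigO_pow_mono hl (isBigO_mul_pow_smul (1 / 12) 3 (isBigO_const_pow_zero (l := l) Q))
    (by norm_num : 1 ≤ 3 + 0)
  have h2 := isBigO_mul_pow_smul 1 1 (isBigO_const_pow_zero (l := l) (ContinuousLinearMap.id ℝ E))
  refine (((isBigO_pow_mono hl hD (by norm_num : 1 ≤ 5)).add h1).add h2).congr_left fun h => ?_
  module

/-- A solution of the scheme whose momentum stays bounded moves by `O(h)` only. -/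
theorem position_isBigO_of_delta_expansion (hl : l ≤ 𝓝 0)
    (hD : (fun h => D h - h • ContinuousLinearMap.id ℝ E - (h ^ 3 / 12) • Q) =O[l]
      fun h => h ^ 5)
    (hX : ∀ᶠ h in l, X h - x = D h ((1 / 2 : ℝ) • (p + P h)))
    (hP : P =O[l] fun h => h ^ 0) : (fun h => X h - x) =O[l] fun h => h ^ 1 :=
  (isBigO_clm_apply (isBigO_one_of_delta_expansion hl hD)
    (((isBigO_const_pow_zero p).add hP).const_smul_left (1 / 2 : ℝ))).congr'
      (hX.mono fun _ hh => hh.symm) (Eventually.of_forall fun _ => rfl)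

/-- Expansion of one step of the scheme, for an increment function `G` (the value of the discrete
gradient) with quadratic Taylor polynomial `a + Q d / 2 + B(d, d) / 6`. The position gains one order
over the momentum, because `G` enters it with the factor `δ²`. -/
theorem numerical_expansion (hl : l ≤ 𝓝 0) (B : E →L[ℝ] E →L[ℝ] E)
    (hD : (fun h => D h - h • ContinuousLinearMap.id ℝ E - (h ^ 3 / 12) • Q) =O[l]
      fun h => h ^ 5)
    (hX : ∀ᶠ h in l, X h - x = D h ((1 / 2 : ℝ) • (p + P h)))
    (hP : ∀ᶠ h in l, P h - p = -D h (G h))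
    (hΔ : (fun h => X h - x) =O[l] fun h => h ^ 1)
    (hG : (fun h => G h - a - (1 / 2 : ℝ) • Q (X h - x) -
      (1 / 6 : ℝ) • B (X h - x) (X h - x)) =O[l] fun h => h ^ 3) :
    ((fun h => X h - x - (h • p - (h ^ 2 / 2) • a - (h ^ 3 / 6) • Q p + (h ^ 4 / 24) • Q a -
      (h ^ 4 / 12) • B p p)) =O[l] fun h => h ^ 5) ∧
    ((fun h => P h - (p - h • a - (h ^ 2 / 2) • Q p + (h ^ 3 / 6) • Q a -
      (h ^ 3 / 6) • B p p)) =O[l] fun h => h ^ 4) := by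
  have hD1 := isBigO_one_of_delta_expansion hl hD
  set e : ℝ → E →L[ℝ] E :=
    fun h => D h - h • ContinuousLinearMap.id ℝ E - (h ^ 3 / 12) • Q with he
  have hDv : ∀ h v, D h v = h • v + (h ^ 3 / 12) • Q v + e h v := fun h v => by
    simp [he]
  set Δ : ℝ → E := fun h => X h - x with hΔdef
  have hGa : (fun h => G h - a) =O[l] fun h => h ^ 1 := by
    refine (((isBigO_pow_mono hl hG (by norm_num : 1 ≤ 3)).add
      ((isBigO_clm_comp Q hΔ).const_smul_left (1 / 2 : ℝ))).add
      ((isBigO_pow_mono hl (isBigO_bilin (B := B) hΔ hΔ)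
        (by norm_num : 1 ≤ 1 + 1)).const_smul_left (1 / 6 : ℝ))).congr_left fun h => ?_
    simp only [hΔdef, Pi.smul_apply]
    abel
  have hG0 : G =O[l] fun h => h ^ 0 :=
    ((isBigO_pow_mono hl hGa (by norm_num : 0 ≤ 1)).add (isBigO_const_pow_zero a)).congr_left
      fun h => sub_add_cancel _ _
  have heG := isBigO_clm_apply hD hG0
  -- the remainder of `δ² G` after the terms of order two and four
  set R : ℝ → E := fun h => (1 * h ^ 1) • e h (G h) + (1 / 144 * h ^ 6) • Q (Q (G h)) +
    (1 / 12 * h ^ 3) • Q (e h (G h)) + e h (D h (G h)) with hR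
  have hRO : R =O[l] fun h => h ^ 6 :=
    (((isBigO_mul_pow_smul 1 1 heG).add
      (isBigO_mul_pow_smul (1 / 144) 6 (isBigO_clm_comp Q (isBigO_clm_comp Q hG0)))).add
      (isBigO_pow_mono hl (isBigO_mul_pow_smul (1 / 12) 3 (isBigO_clm_comp Q heG))
        (by norm_num))).add
      (isBigO_pow_mono hl (isBigO_clm_apply hD (isBigO_clm_apply hD1 hG0)) (by norm_num))
  have hΔeq : ∀ᶠ h in l, Δ h = h • p + (h ^ 3 / 12) • Q p + e h p -
      (1 / 2 : ℝ) • (h ^ 2 • G h + (h ^ 4 / 6) • Q (G h) + R h) := by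
    filter_upwards [hX, hP] with h h1 h2
    have h3 : P h = p - D h (G h) := by rw [sub_eq_add_neg, ← h2]; abel
    have h4 : D h (D h (G h)) = h ^ 2 • G h + (h ^ 4 / 6) • Q (G h) + R h := by
      rw [hDv h (D h (G h))]
      simp only [hR]
      rw [hDv h (G h)]
      simp only [map_add, map_smul]
      module
    have h5 : Δ h = D h p - (1 / 2 : ℝ) • D h (D h (G h)) := by
      simp only [hΔdef]
      rw [h1, h3]
      simp only [map_smul, map_add, map_sub]
      module
    rw [h5, h4, hDv h p]
  have hp0 : (fun _ : ℝ => p) =O[l] fun h => h ^ 0 := isBigO_const_pow_zero p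
  have hep := isBigO_clm_apply hD hp0
  have hQp := isBigO_mul_pow_smul (1 / 12) 3 (isBigO_clm_comp Q hp0)
  have hQG := isBigO_mul_pow_smul (1 / 12) 4 (isBigO_clm_comp Q hG0)
  have s3 : (fun h => Δ h - h • p + (h ^ 2 / 2) • a) =O[l] fun h => h ^ 3 := by
    refine ((((hQp.add (isBigO_pow_mono hl hep (by norm_num : 3 ≤ 5 + 0))).sub
      (isBigO_mul_pow_smul (1 / 2) 2 hGa)).sub
      (isBigO_pow_mono hl hQG (by norm_num : 3 ≤ 4 + 0))).sub
      ((isBigO_pow_mono hl hRO (by norm_num : 3 ≤ 6)).const_smul_left (1 / 2 : ℝ))).congr'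
      (hΔeq.mono fun h hh => ?_) (Eventually.of_forall fun _ => rfl)
    beta_reduce
    rw [hh]
    simp only [Pi.smul_apply]
    module
  have s2 : (fun h => Δ h - h • p) =O[l] fun h => h ^ 2 := by
    refine ((isBigO_pow_mono hl s3 (by norm_num : 2 ≤ 3)).sub
      (isBigO_mul_pow_smul (1 / 2) 2 (isBigO_const_pow_zero a))).congr_left fun h => ?_
    module
  have s5 : (fun h => G h - (a + (h / 2) • Q p - (h ^ 2 / 4) • Q a + (h ^ 2 / 6) • B p p)) =O[l]
      fun h => h ^ 3 := by
    refine ((hG.add ((isBigO_clm_comp Q s3).const_smul_left (1 / 2 : ℝ))).add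
      (((isBigO_bilin (B := B) s2 hΔ).add
        (isBigO_mul_pow_smul 1 1 (isBigO_bilin (B := B) hp0 s2))).const_smul_left
          (1 / 6 : ℝ))).congr_left fun h => ?_
    change _ - a - _ • Q (Δ h) - _ • B (Δ h) (Δ h) + _ + _ = _
    simp only [Pi.smul_apply, map_add, map_sub, map_smul, sub_apply,
      smul_apply]
    module
  have hQGa := isBigO_clm_comp Q hGa
  constructor
  · refine ((((isBigO_pow_mono hl hep (by norm_num : 5 ≤ 5 + 0))).sub
      ((isBigO_pow_mono hl hRO (by norm_num : 5 ≤ 6)).const_smul_left (1 / 2 : ℝ))).sub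
      (isBigO_mul_pow_smul (1 / 2) 2 s5) |>.sub (isBigO_mul_pow_smul (1 / 12) 4 hQGa)).congr'
      (hΔeq.mono fun h hh => ?_) (Eventually.of_forall fun _ => rfl)
    change _ = Δ h - _
    rw [hh]
    simp only [Pi.smul_apply, map_sub]
    module
  · refine (((isBigO_mul_pow_smul (-1) 1 s5).sub (isBigO_mul_pow_smul (1 / 12) 3 hQGa)).sub
      (isBigO_pow_mono hl heG (by norm_num : 4 ≤ 5 + 0))).congr'
      (hP.mono fun h hh => ?_) (Eventually.of_forall fun _ => rfl)
    beta_reduce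
    rw [sub_eq_iff_eq_add.1 hh, hDv]
    simp only [map_sub]
    module

/-- One more order for the momentum when the increment function is affine up to `O(|d|⁴)`. The
position is already covered by `numerical_expansion` with `B = 0`. -/
theorem numerical_expansion_of_flat (hl : l ≤ 𝓝 0)
    (hD : (fun h => D h - h • ContinuousLinearMap.id ℝ E - (h ^ 3 / 12) • Q) =O[l]
      fun h => h ^ 5)
    (hX : ∀ᶠ h in l, X h - x = D h ((1 / 2 : ℝ) • (p + P h)))
    (hP : ∀ᶠ h in l, P h - p = -D h (G h))
    (hΔ : (fun h => X h - x) =O[l] fun h => h ^ 1)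
    (hG : (fun h => G h - a - (1 / 2 : ℝ) • Q (X h - x)) =O[l] fun h => h ^ 4) :
    (fun h => P h - (p - h • a - (h ^ 2 / 2) • Q p + (h ^ 3 / 6) • Q a +
      (h ^ 4 / 24) • Q (Q p))) =O[l] fun h => h ^ 5 := by
  have hX5 := (numerical_expansion hl 0 hD hX hP hΔ (by
    simpa using isBigO_pow_mono hl hG (by norm_num : 3 ≤ 4))).1
  have hX4 : (fun h => X h - x - (h • p - (h ^ 2 / 2) • a - (h ^ 3 / 6) • Q p)) =O[l]
      fun h => h ^ 4 := by
    refine ((isBigO_pow_mono hl hX5 (by norm_num : 4 ≤ 5)).add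
      (isBigO_mul_pow_smul (1 / 24) 4 (isBigO_const_pow_zero (Q a)))).congr_left fun h => ?_
    simp only [zero_apply]
    module
  have s1 : (fun h => G h - (a + (h / 2) • Q p - (h ^ 2 / 4) • Q a - (h ^ 3 / 12) • Q (Q p))) =O[l]
      fun h => h ^ 4 := by
    refine (hG.add ((isBigO_clm_comp Q hX4).const_smul_left (1 / 2 : ℝ))).congr_left fun h => ?_
    simp only [Pi.smul_apply, map_sub, map_smul]
    module
  have s2 : (fun h => G h - a - (h / 2) • Q p) =O[l] fun h => h ^ 2 := by
    refine (((isBigO_pow_mono hl s1 (by norm_num : 2 ≤ 4)).sub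
      (isBigO_mul_pow_smul (1 / 4) 2 (isBigO_const_pow_zero (Q a)))).sub
      (isBigO_pow_mono hl (isBigO_mul_pow_smul (1 / 12) 3 (isBigO_const_pow_zero (Q (Q p))))
        (by norm_num : 2 ≤ 3 + 0))).congr_left fun h => ?_
    module
  have hG0 : G =O[l] fun h => h ^ 0 := by
    refine (((isBigO_pow_mono hl s2 (by norm_num : 0 ≤ 2)).add
      (isBigO_pow_mono hl (isBigO_mul_pow_smul (1 / 2) 1 (isBigO_const_pow_zero (Q p)))
        (by norm_num : 0 ≤ 1 + 0))).add (isBigO_const_pow_zero a)).congr_left fun h => ?_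
    module
  refine (((isBigO_mul_pow_smul (-1) 1 s1).sub
      (isBigO_mul_pow_smul (1 / 12) 3 (isBigO_clm_comp Q s2))).sub
      (isBigO_pow_mono hl (isBigO_clm_apply hD hG0) (by norm_num : 5 ≤ 5 + 0))).congr'
      (hP.mono fun h hh => ?_) (Eventually.of_forall fun _ => rfl)
  beta_reduce
  rw [sub_eq_iff_eq_add.1 hh]
  simp only [map_sub, map_smul, sub_apply, smul_apply,
    ContinuousLinearMap.id_apply]
  module

end Numerical

section Exact

variable {E : Type*} [NormedAddCommGroup E] [NormedSpace ℝ E]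
  {Q : E →L[ℝ] E} {ξ η F : ℝ → E} {x p a : E}

/-- Expansion of the solution of `ẋ = p`, `ṗ = -F`, where `F` is the value of the gradient along the
solution and has the quadratic Taylor polynomial `a + Q d + S(d, d) / 2`. -/
theorem exact_expansion (S : E →L[ℝ] E →L[ℝ] E)
    (hx : ξ 0 = x) (hp : η 0 = p) (hξ : ∀ᶠ t in 𝓝 0, HasDerivAt ξ (η t) t)
    (hη : ∀ᶠ t in 𝓝 0, HasDerivAt η (-F t) t)
    (hF : (fun t => F t - a - Q (ξ t - x) - (1 / 2 : ℝ) • S (ξ t - x) (ξ t - x)) =O[𝓝 0]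
      fun t => t ^ 3) :
    ((fun t => ξ t - x - (t • p - (t ^ 2 / 2) • a - (t ^ 3 / 6) • Q p + (t ^ 4 / 24) • Q a -
      (t ^ 4 / 24) • S p p)) =O[𝓝 0] fun t => t ^ 5) ∧
    ((fun t => η t - (p - t • a - (t ^ 2 / 2) • Q p + (t ^ 3 / 6) • Q a -
      (t ^ 3 / 6) • S p p)) =O[𝓝 0] fun t => t ^ 4) := by
  have hl : 𝓝 (0 : ℝ) ≤ 𝓝 0 := le_rfl
  have hΔ : (fun t => ξ t - x) =O[𝓝 0] fun t => t ^ 1 := by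
    simpa [hx] using hξ.self_of_nhds.isBigO_sub
  have hFa : (fun t => F t - a) =O[𝓝 0] fun t => t ^ 1 := by
    refine (((isBigO_pow_mono hl hF (by norm_num : 1 ≤ 3)).add (isBigO_clm_comp Q hΔ)).add
      ((isBigO_pow_mono hl (isBigO_bilin (B := S) hΔ hΔ)
        (by norm_num : 1 ≤ 1 + 1)).const_smul_left (1 / 2 : ℝ))).congr_left fun h => ?_
    simp only [Pi.smul_apply]
    abel
  have hpow : ∀ (k : ℕ) (v : E) (t : ℝ),
      HasDerivAt (fun t : ℝ => t ^ (k + 1) • v) (((k + 1 : ℝ) * t ^ k) • v) t := fun k v t => by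
    simpa using (hasDerivAt_pow (k + 1) t).smul_const v
  have e2 : (fun t => η t - p + t • a) =O[𝓝 0] fun t => t ^ 2 := by
    refine isBigO_pow_succ_of_hasDerivAt (k := 1) (u' := fun t => -(F t - a)) ?_ (by simp [hp])
      hFa.neg_left
    filter_upwards [hη] with t ht
    refine ((ht.sub_const p).add ((hasDerivAt_id t).smul_const a)).congr_deriv ?_
    module
  have x3 : (fun t => ξ t - x - t • p + (t ^ 2 / 2) • a) =O[𝓝 0] fun t => t ^ 3 := by
    refine isBigO_pow_succ_of_hasDerivAt (k := 2) ?_ (by simp [hx]) e2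
    filter_upwards [hξ] with t ht
    refine (((ht.sub_const x).sub ((hasDerivAt_id t).smul_const p)).add
      ((((hasDerivAt_pow 2 t).div_const 2)).smul_const a)).congr_deriv ?_
    push_cast
    module
  have x2 : (fun t => ξ t - x - t • p) =O[𝓝 0] fun t => t ^ 2 := by
    refine ((isBigO_pow_mono hl x3 (by norm_num : 2 ≤ 3)).sub
      (isBigO_mul_pow_smul (1 / 2) 2 (isBigO_const_pow_zero a))).congr_left fun h => ?_
    module
  have f3 : (fun t => F t - (a + t • Q p - (t ^ 2 / 2) • Q a + (t ^ 2 / 2) • S p p)) =O[𝓝 0]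
      fun t => t ^ 3 := by
    refine ((hF.add (isBigO_clm_comp Q x3)).add
      (((isBigO_bilin (B := S) x2 hΔ).add
        (isBigO_mul_pow_smul 1 1 (isBigO_bilin (B := S) (isBigO_const_pow_zero p)
          x2))).const_smul_left (1 / 2 : ℝ))).congr_left fun h => ?_
    simp only [Pi.smul_apply, map_add, map_sub, map_smul, sub_apply,
      smul_apply]
    module
  have e4 : (fun t => η t - (p - t • a - (t ^ 2 / 2) • Q p + (t ^ 3 / 6) • Q a -
      (t ^ 3 / 6) • S p p)) =O[𝓝 0] fun t => t ^ 4 := by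
    refine isBigO_pow_succ_of_hasDerivAt (k := 3) ?_ (by simp [hp]) f3.neg_left
    filter_upwards [hη] with t ht
    refine (ht.sub (((((hasDerivAt_const t p).sub ((hasDerivAt_id t).smul_const a)).sub
      (((hasDerivAt_pow 2 t).div_const 2).smul_const (Q p))).add
      (((hasDerivAt_pow 3 t).div_const 6).smul_const (Q a))).sub
      (((hasDerivAt_pow 3 t).div_const 6).smul_const (S p p)))).congr_deriv ?_
    push_cast
    module
  refine ⟨?_, e4⟩
  refine isBigO_pow_succ_of_hasDerivAt (k := 4) ?_ (by simp [hx]) e4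
  filter_upwards [hξ] with t ht
  refine ((ht.sub_const x).sub ((((((hasDerivAt_id t).smul_const p).sub
    (((hasDerivAt_pow 2 t).div_const 2).smul_const a)).sub
    (((hasDerivAt_pow 3 t).div_const 6).smul_const (Q p))).add
    (((hasDerivAt_pow 4 t).div_const 24).smul_const (Q a))).sub
    (((hasDerivAt_pow 4 t).div_const 24).smul_const (S p p)))).congr_deriv ?_
  push_cast
  module

/-- One more order for the momentum when the gradient is affine up to `O(|d|⁴)`. -/
theorem exact_expansion_of_flat
    (hx : ξ 0 = x) (hp : η 0 = p) (hξ : ∀ᶠ t in 𝓝 0, HasDerivAt ξ (η t) t)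
    (hη : ∀ᶠ t in 𝓝 0, HasDerivAt η (-F t) t)
    (hF : (fun t => F t - a - Q (ξ t - x)) =O[𝓝 0] fun t => t ^ 4) :
    (fun t => η t - (p - t • a - (t ^ 2 / 2) • Q p + (t ^ 3 / 6) • Q a +
      (t ^ 4 / 24) • Q (Q p))) =O[𝓝 0] fun t => t ^ 5 := by
  have hl : 𝓝 (0 : ℝ) ≤ 𝓝 0 := le_rfl
  have hx5 := (exact_expansion 0 hx hp hξ hη (by
    simpa using isBigO_pow_mono hl hF (by norm_num : 3 ≤ 4))).1
  have hx4 : (fun h => ξ h - x - (h • p - (h ^ 2 / 2) • a - (h ^ 3 / 6) • Q p)) =O[𝓝 0]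
      fun h => h ^ 4 := by
    refine ((isBigO_pow_mono hl hx5 (by norm_num : 4 ≤ 5)).add
      (isBigO_mul_pow_smul (1 / 24) 4 (isBigO_const_pow_zero (Q a)))).congr_left fun h => ?_
    simp only [zero_apply]
    module
  have f4 : (fun t => F t - (a + t • Q p - (t ^ 2 / 2) • Q a - (t ^ 3 / 6) • Q (Q p))) =O[𝓝 0]
      fun t => t ^ 4 := by
    refine (hF.add (isBigO_clm_comp Q hx4)).congr_left fun h => ?_
    simp only [map_sub, map_smul]
    module
  refine isBigO_pow_succ_of_hasDerivAt (k := 4) ?_ (by simp [hp]) f4.neg_left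
  filter_upwards [hη] with t ht
  refine (ht.sub (((((hasDerivAt_const t p).sub ((hasDerivAt_id t).smul_const a)).sub
    (((hasDerivAt_pow 2 t).div_const 2).smul_const (Q p))).add
    (((hasDerivAt_pow 3 t).div_const 6).smul_const (Q a))).add
    (((hasDerivAt_pow 4 t).div_const 24).smul_const (Q (Q p))))).congr_deriv ?_
  push_cast
  module

end Exact

/-! ### Solvability of the implicit equations and of the differential equation -/

/-- Unique solvability of `z - z₀ = A (κ z)` in a fixed ball, for all small operators `A`, by
Banach's fixed point theorem. -/
theorem exists_ball_existsUnique_sub_eq {Z : Type*} [NormedAddCommGroup Z] [NormedSpace ℝ Z]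
    [CompleteSpace Z] {κ : Z → Z} {z₀ : Z} (hκ : ContDiffAt ℝ 1 κ z₀) {s : Set Z} (hs : s ∈ 𝓝 z₀)
    {l : Filter ℝ} {A : ℝ → Z →L[ℝ] Z} (hA : Tendsto A l (𝓝 0)) :
    ∃ ρ > 0, Metric.ball z₀ ρ ⊆ s ∧
      ∀ᶠ h in l, ∃! z, z ∈ Metric.ball z₀ ρ ∧ z - z₀ = A h (κ z) := by
  obtain ⟨K, t, ht, hK⟩ := hκ.exists_lipschitzOnWith
  obtain ⟨ρ, hρ, hball⟩ := Metric.mem_nhds_iff.1 (inter_mem ht hs)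
  refine ⟨ρ, hρ, fun z hz => (hball hz).2, ?_⟩
  have hn : Tendsto (fun h => ‖A h‖) l (𝓝 0) := by simpa using hA.norm
  have h1 : ∀ᶠ h in l, ‖A h‖ * K < 1 / 2 := by
    have := hn.mul_const (K : ℝ)
    rw [zero_mul] at this
    exact this.eventually (gt_mem_nhds (by norm_num))
  have h2 : ∀ᶠ h in l, ‖A h‖ * ‖κ z₀‖ < ρ / 4 := by
    have := hn.mul_const ‖κ z₀‖
    rw [zero_mul] at this
    exact this.eventually (gt_mem_nhds (by positivity))
  filter_upwards [h1, h2] with h h1 h2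
  have hlip : ∀ z ∈ Metric.ball z₀ ρ, ∀ w ∈ Metric.ball z₀ ρ,
      ‖A h (κ z) - A h (κ w)‖ ≤ 1 / 2 * ‖z - w‖ := fun z hz w hw => by
    rw [← map_sub]
    calc _ ≤ ‖A h‖ * ‖κ z - κ w‖ := (A h).le_opNorm _
      _ ≤ ‖A h‖ * (K * ‖z - w‖) := by
        gcongr
        exact hK.norm_sub_le (hball hz).1 (hball hw).1
      _ ≤ _ := by
        rw [← mul_assoc]
        gcongr
  have hsub : Metric.closedBall z₀ (ρ / 2) ⊆ Metric.ball z₀ ρ :=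
    Metric.closedBall_subset_ball (by linarith)
  -- `T` maps the closed ball of half the radius into itself and is a `1/2`-contraction there
  set T : Z → Z := fun z => z₀ + A h (κ z) with hT
  have hmaps : MapsTo T (Metric.closedBall z₀ (ρ / 2)) (Metric.closedBall z₀ (ρ / 2)) := by
    intro z hz
    have h3 := hlip z (hsub hz) z₀ (Metric.mem_ball_self hρ)
    have h4 : ‖A h (κ z₀)‖ ≤ ‖A h‖ * ‖κ z₀‖ := (A h).le_opNorm _
    have h5 : ‖A h (κ z)‖ ≤ ‖A h (κ z) - A h (κ z₀)‖ + ‖A h (κ z₀)‖ := by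
      simpa using norm_add_le (A h (κ z) - A h (κ z₀)) (A h (κ z₀))
    rw [mem_closedBall_iff_norm] at hz ⊢
    rw [hT, add_sub_cancel_left]
    linarith
  have hcontr : ContractingWith (1 / 2) (hmaps.restrict T _ _) := by
    refine ⟨by norm_num, LipschitzWith.of_dist_le_mul fun z w => ?_⟩
    rw [Subtype.dist_eq, Subtype.dist_eq, dist_eq_norm, dist_eq_norm]
    simpa [hT] using hlip z (hsub z.2) w (hsub w.2)
  obtain ⟨z, hz, hfix, -⟩ := hcontr.exists_fixedPoint' Metric.isClosed_closedBall.isComplete hmaps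
    (Metric.mem_closedBall_self (by linarith : 0 ≤ ρ / 2)) (edist_ne_top _ _)
  have hfix' : z₀ + A h (κ z) = z := hfix
  refine ⟨z, ⟨hsub hz, sub_eq_iff_eq_add'.2 hfix'.symm⟩, fun w ⟨hw, hw'⟩ => ?_⟩
  have h6 := hlip w hw z (hsub hz)
  rw [← hw', ← sub_eq_iff_eq_add'.2 hfix'.symm, sub_sub_sub_cancel_right] at h6
  have h7 : ‖w - z‖ = 0 := le_antisymm (by linarith) (norm_nonneg _)
  exact sub_eq_zero.1 (norm_eq_zero.1 h7)

theorem exists_ball_existsUnique_implicit_step {E : Type*} [NormedAddCommGroup E]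
    [NormedSpace ℝ E] [CompleteSpace E] {k : E → E} {x : E} (hk : ContDiffAt ℝ 1 k x) (p : E)
    {s : Set E} (hs : s ∈ 𝓝 x) {l : Filter ℝ} {D : ℝ → E →L[ℝ] E} (hD : Tendsto D l (𝓝 0)) :
    ∃ ρ > 0, Metric.ball x ρ ⊆ s ∧ ∀ᶠ h in l, ∃! z : E × E, z ∈ Metric.ball (x, p) ρ ∧
      z.1 - x = D h ((1 / 2 : ℝ) • (p + z.2)) ∧ z.2 - p = -D h (k z.1) := by
  have hA : Tendsto (fun h => (D h).prodMap (D h)) l (𝓝 0) := by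
    refine squeeze_zero_norm (fun h => ?_) (by simpa using hD.norm)
    refine ContinuousLinearMap.opNorm_le_bound _ (norm_nonneg _) fun v => ?_
    refine max_le (((D h).le_opNorm _).trans ?_) (((D h).le_opNorm _).trans ?_)
    · gcongr
      exact norm_fst_le v
    · gcongr
      exact norm_snd_le v
  have hκ : ContDiffAt ℝ 1 (fun z : E × E => ((1 / 2 : ℝ) • (p + z.2), -k z.1)) (x, p) := by
    have h1 : ContDiffAt ℝ 1 (fun z : E × E => k z.1) (x, p) :=
      ContDiffAt.comp (x, p) (g := k) hk contDiffAt_fst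
    exact ContDiffAt.prodMk (by fun_prop) h1.neg
  obtain ⟨ρ, hρ, hsub, hev⟩ := exists_ball_existsUnique_sub_eq hκ
    (prod_mem_nhds hs univ_mem) hA
  refine ⟨ρ, hρ, fun y hy => (hsub (show (y, p) ∈ Metric.ball (x, p) ρ by
    simpa [Prod.dist_eq] using hy)).1,
    hev.mono fun h hh => ?_⟩
  convert hh using 2 with z
  simp [Prod.ext_iff]

/-- Local existence for `ẋ = p`, `ṗ = -f(x)`, with the position staying in a given neighbourhood. -/
theorem exists_hamiltonian_solution {E : Type*} [NormedAddCommGroup E]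
    [NormedSpace ℝ E] [CompleteSpace E] {f : E → E} {x : E} (hf : ContDiffAt ℝ 1 f x) (p : E)
    {s : Set E} (hs : s ∈ 𝓝 x) :
    ∃ ε > 0, ∃ ξ η : ℝ → E, ξ 0 = x ∧ η 0 = p ∧ ∀ t ∈ Ioo (-ε) ε,
      ξ t ∈ s ∧ HasDerivAt ξ (η t) t ∧ HasDerivAt η (-f (ξ t)) t := by
  have hF : ContDiffAt ℝ 1 (fun z : E × E => (z.2, -f z.1)) (x, p) := by
    have h1 : ContDiffAt ℝ 1 (fun z : E × E => f z.1) (x, p) :=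
      ContDiffAt.comp (x, p) (g := f) hf contDiffAt_fst
    exact ContDiffAt.prodMk (by fun_prop) h1.neg
  obtain ⟨α, hα0, ε, hε, hα⟩ :=
    hF.exists_forall_mem_closedBall_exists_eq_forall_mem_Ioo_hasDerivAt₀ 0
  simp only [zero_sub, zero_add] at hα
  have hfst : ∀ t ∈ Ioo (-ε) ε, HasDerivAt (fun t => (α t).1) (α t).2 t := fun t ht =>
    (ContinuousLinearMap.fst ℝ E E).hasFDerivAt.comp_hasDerivAt t (hα t ht)
  have hsnd : ∀ t ∈ Ioo (-ε) ε, HasDerivAt (fun t => (α t).2) (-f (α t).1) t := fun t ht =>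
    (ContinuousLinearMap.snd ℝ E E).hasFDerivAt.comp_hasDerivAt t (hα t ht)
  have hcont : ContinuousAt (fun t => (α t).1) 0 := (hfst 0 ⟨by linarith, hε⟩).continuousAt
  obtain ⟨ε', hε', hs'⟩ := Metric.mem_nhds_iff.1 (hcont (by simpa [hα0] using hs))
  refine ⟨min ε ε', lt_min hε hε', fun t => (α t).1, fun t => (α t).2, by simp [hα0],
    by simp [hα0], fun t ht => ?_⟩
  have ht' : t ∈ Ioo (-ε) ε :=
    ⟨by linarith [ht.1, min_le_left ε ε'], ht.2.trans_le (min_le_left _ _)⟩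
  refine ⟨hs' ?_, hfst t ht', hsnd t ht'⟩
  rw [mem_ball_zero_iff, Real.norm_eq_abs, abs_lt]
  exact ⟨by linarith [ht.1, min_le_right ε ε'], ht.2.trans_le (min_le_right _ _)⟩

/-! ### Taylor coefficients of a symmetric discrete gradient -/

section Taylor

variable {X Y Z : Type*} [NormedAddCommGroup X] [NormedSpace ℝ X] [NormedAddCommGroup Y]
  [NormedSpace ℝ Y] [NormedAddCommGroup Z] [NormedSpace ℝ Z]

theorem fderiv_fderiv_comp_affine {G : X → Y} {ι : Z → X} {L : Z →L[ℝ] X} {y : Z}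
    (hι : ∀ y, HasFDerivAt ι L y) (hG : ContDiffAt ℝ ∞ G (ι y)) (v w : Z) :
    fderiv ℝ (fderiv ℝ (fun y => G (ι y))) y v w =
      fderiv ℝ (fderiv ℝ G) (ι y) (L v) (L w) := by
  have hev : ∀ᶠ y' in 𝓝 y, DifferentiableAt ℝ G (ι y') :=
    (hι y).continuousAt.eventually (((hG.of_le (m := 1) (by exact_mod_cast le_top)).eventually
      (by simp)).mono fun z hz => hz.differentiableAt (by simp))
  have h1 : fderiv ℝ (fun y => G (ι y)) =ᶠ[𝓝 y] fun y' => (fderiv ℝ G (ι y')).comp L :=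
    hev.mono fun y' hy' => (hy'.hasFDerivAt.comp y' (hι y')).fderiv
  have h2 : DifferentiableAt ℝ (fderiv ℝ G) (ι y) :=
    (hG.fderiv_right (m := ∞) (by simp)).differentiableAt (by simp)
  have h3 : HasFDerivAt (fun y' => (fderiv ℝ G (ι y')).comp L) _ y :=
    (h2.hasFDerivAt.comp y (hι y)).clm_comp (hasFDerivAt_const L y)
  rw [h1.fderiv_eq, h3.fderiv]
  simp

theorem taylor_two_isBigO [CompleteSpace Y] {f : X → Y} {x : X} (hf : ContDiffAt ℝ ∞ f x) :
    (fun d => f (x + d) - f x - fderiv ℝ f x d - (1 / 2 : ℝ) • fderiv ℝ (fderiv ℝ f) x d d)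
      =O[𝓝 0] fun d => ‖d‖ ^ 3 := by
  have ht : Tendsto (fun d : X => (x, d)) (𝓝 0) (𝓝 (x, 0)) :=
    (Continuous.prodMk_right x).tendsto 0
  refine ((taylor_isBigO_uniform 2 hf).comp_tendsto ht).congr_left fun d => ?_
  simp only [Function.comp_apply, Finset.sum_range_succ, Finset.sum_range_zero,
    iteratedFDeriv_zero_apply, iteratedFDeriv_one_apply, iteratedFDeriv_two_apply]
  norm_num
  abel

theorem taylor_one_isBigO_of_fderiv_fderiv_eq_zero [CompleteSpace Y] {f : X → Y} {x : X}
    (hf : ContDiffAt ℝ ∞ f x) (h0 : ∀ᶠ y in 𝓝 x, fderiv ℝ (fderiv ℝ f) y = 0) :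
    (fun d => f (x + d) - f x - fderiv ℝ f x d) =O[𝓝 0] fun d => ‖d‖ ^ 4 := by
  have ht : Tendsto (fun d : X => (x, d)) (𝓝 0) (𝓝 (x, 0)) :=
    (Continuous.prodMk_right x).tendsto 0
  refine ((taylor_isBigO_uniform 3 hf).comp_tendsto ht).congr_left fun d => ?_
  -- the third derivative vanishes since the second one does so near `x`
  have h2 : iteratedFDeriv ℝ 2 f =ᶠ[𝓝 x] fun _ => 0 := by
    filter_upwards [h0] with y hy
    ext m
    rw [iteratedFDeriv_two_apply, hy]
    rfl
  have h3 : iteratedFDeriv ℝ 3 f x (fun _ => d) = 0 := by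
    rw [iteratedFDeriv_succ_apply_left, h2.fderiv_eq]
    simp
  simp only [Function.comp_apply, Finset.sum_range_succ, Finset.sum_range_zero,
    iteratedFDeriv_zero_apply, iteratedFDeriv_one_apply, iteratedFDeriv_two_apply, h3,
    h0.self_of_nhds]
  norm_num
  abel

/-- In the symmetric second difference the odd Taylor terms cancel, so the remainder is of order
four. -/
theorem second_difference_isBigO_uniform [CompleteSpace Y] {G : X → Y} {z₀ : X}
    (hG : ContDiffAt ℝ ∞ G z₀) :
    (fun q : X × X => G (q.1 + q.2) + G (q.1 - q.2) - (2 : ℝ) • G q.1 -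
      fderiv ℝ (fderiv ℝ G) q.1 q.2 q.2) =O[𝓝 (z₀, 0)] fun q => ‖q.2‖ ^ 4 := by
  have h1 := taylor_isBigO_uniform 3 hG
  have ht : Tendsto (fun q : X × X => (q.1, -q.2)) (𝓝 (z₀, 0)) (𝓝 (z₀, 0)) := by
    have : Continuous fun q : X × X => (q.1, -q.2) := by fun_prop
    simpa using this.tendsto (z₀, 0)
  have h2 := (h1.comp_tendsto ht).congr_right (g₂ := fun q => ‖q.2‖ ^ 4) fun q => by simp
  refine (h1.add h2).congr_left fun q => ?_
  have h3 : iteratedFDeriv ℝ 3 G q.1 (fun _ => -q.2) = -iteratedFDeriv ℝ 3 G q.1 fun _ => q.2 := by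
    have := (iteratedFDeriv ℝ 3 G q.1).map_smul_univ (fun _ => (-1 : ℝ)) fun _ => q.2
    norm_num [Finset.prod_const] at this
    exact this
  simp only [Function.comp_apply, Finset.sum_range_succ, Finset.sum_range_zero,
    iteratedFDeriv_zero_apply, iteratedFDeriv_one_apply, iteratedFDeriv_two_apply, h3, map_neg,
    neg_apply, neg_neg, ← sub_eq_add_neg]
  norm_num [Nat.factorial]
  module

end Taylor

section Symmetric

variable {E : Type*} [NormedAddCommGroup E] [NormedSpace ℝ E]
  {G : E × E → E} {f : E → E} {x : E}

theorem hasFDerivAt_diag (y : E) : HasFDerivAt (fun y : E => (y, y))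
    ((ContinuousLinearMap.id ℝ E).prod (ContinuousLinearMap.id ℝ E)) y :=
  (hasFDerivAt_id y).prodMk (hasFDerivAt_id y)

/-- By symmetry, half of the derivative along the diagonal comes from each argument. -/
theorem fderiv_partial_eq_half (hG : ContDiffAt ℝ ∞ G (x, x))
    (hdiag : ∀ᶠ y in 𝓝 x, G (y, y) = f y) (hsymm : ∀ᶠ z in 𝓝 (x, x), G z.swap = G z) (d : E) :
    fderiv ℝ (fun y => G (x, y)) x d = (1 / 2 : ℝ) • fderiv ℝ f x d := by
  have hd : HasFDerivAt G (fderiv ℝ G (x, x)) (x, x) :=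
    (hG.differentiableAt (by simp)).hasFDerivAt
  have h1 : fderiv ℝ (fun y => G (x, y)) x d = fderiv ℝ G (x, x) (0, d) := by
    have : HasFDerivAt (fun y => G (x, y)) _ x := hd.comp x (hasFDerivAt_prodMk_right x x)
    rw [this.fderiv]
    simp
  have h2 : fderiv ℝ f x d = fderiv ℝ G (x, x) (d, d) := by
    have : HasFDerivAt (fun y => G (y, y)) _ x :=
      HasFDerivAt.comp x (f := fun y => (y, y)) hd (hasFDerivAt_diag x)
    rw [← (EventuallyEq.fderiv_eq (show (fun y => G (y, y)) =ᶠ[𝓝 x] f from hdiag)), this.fderiv]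
    simp
  have h3 : fderiv ℝ G (x, x) (d, 0) = fderiv ℝ G (x, x) (0, d) := by
    have hs : HasFDerivAt G (fderiv ℝ G (x, x)) (ContinuousLinearEquiv.prodComm ℝ E E (x, x)) := hd
    have := hs.comp (x, x) (ContinuousLinearEquiv.prodComm ℝ E E).hasFDerivAt
    have h4 : fderiv ℝ G (x, x) = _ :=
      (EventuallyEq.fderiv_eq (show G =ᶠ[𝓝 (x, x)] G ∘ ContinuousLinearEquiv.prodComm ℝ E E from
        hsymm.mono fun z hz => hz.symm)).trans this.fderiv
    conv_lhs => rw [h4]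
    simp
  have h5 : ((d, d) : E × E) = (d, 0) + (0, d) := by simp
  rw [h1, h2, h5, map_add, h3]
  module

/-- The parallelogram law for `D²G(x, x)` and the vectors `(0, d)`, `(d, 0)`: the value on `(d, d)`
is that of `D²f`, and by symmetry the values on `(d, 0)` and `(0, d)` coincide. -/
theorem fderiv_fderiv_antidiag (hG : ContDiffAt ℝ ∞ G (x, x))
    (hdiag : ∀ᶠ y in 𝓝 x, G (y, y) = f y) (hsymm : ∀ᶠ z in 𝓝 (x, x), G z.swap = G z) (d : E) :
    fderiv ℝ (fderiv ℝ G) (x, x) (-d, d) (-d, d) =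
      (4 : ℝ) • fderiv ℝ (fderiv ℝ fun y => G (x, y)) x d d - fderiv ℝ (fderiv ℝ f) x d d := by
  have h1 := fderiv_fderiv_comp_affine (hasFDerivAt_prodMk_right x) hG d d
  have h2 : fderiv ℝ (fderiv ℝ f) x d d = fderiv ℝ (fderiv ℝ G) (x, x) (d, d) (d, d) := by
    have := fderiv_fderiv_comp_affine (ι := fun y => (y, y)) hasFDerivAt_diag hG d d
    have h3 : fderiv ℝ (fun y => G (y, y)) =ᶠ[𝓝 x] fderiv ℝ f :=
      EventuallyEq.fderiv (show (fun y => G (y, y)) =ᶠ[𝓝 x] f from hdiag)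
    rw [← h3.fderiv_eq, this]
    simp
  have h4 : fderiv ℝ (fderiv ℝ G) (x, x) (d, 0) (d, 0) =
      fderiv ℝ (fderiv ℝ G) (x, x) (0, d) (0, d) := by
    have := fderiv_fderiv_comp_affine (G := G) (ι := ContinuousLinearEquiv.prodComm ℝ E E)
      (L := (ContinuousLinearEquiv.prodComm ℝ E E : E × E →L[ℝ] E × E)) (y := (x, x))
      (fun z => (ContinuousLinearEquiv.prodComm ℝ E E).hasFDerivAt) hG (d, 0) (d, 0)
    have h5 : fderiv ℝ (fun z => G (ContinuousLinearEquiv.prodComm ℝ E E z)) =ᶠ[𝓝 (x, x)]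
        fderiv ℝ G := EventuallyEq.fderiv (show _ =ᶠ[𝓝 (x, x)] G from hsymm)
    rw [h5.fderiv_eq] at this
    simpa using this
  simp only [ContinuousLinearMap.inr_apply] at h1
  have e1 : ((-d, d) : E × E) = (0, d) - (d, 0) := by simp
  have e2 : ((d, d) : E × E) = (0, d) + (d, 0) := by simp
  rw [h1, h2, e1, e2]
  simp only [map_add, map_sub, add_apply, sub_apply, h4]
  module

variable [CompleteSpace E]

/-- The factors `1 / 6` and `3` match the normalization of the coefficients `B_{γμν}`. -/
theorem symmetric_taylor_two_isBigO (hG : ContDiffAt ℝ ∞ G (x, x))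
    (hdiag : ∀ᶠ y in 𝓝 x, G (y, y) = f y) (hsymm : ∀ᶠ z in 𝓝 (x, x), G z.swap = G z) :
    (fun d => G (x, x + d) - f x - (1 / 2 : ℝ) • fderiv ℝ f x d -
      (1 / 6 : ℝ) • ((3 : ℝ) • fderiv ℝ (fderiv ℝ fun y => G (x, y)) x) d d) =O[𝓝 0]
      fun d => ‖d‖ ^ 3 := by
  have h : ContDiffAt ℝ ∞ (fun y => G (x, y)) x :=
    ContDiffAt.comp x (g := G) hG (by fun_prop)
  refine (taylor_two_isBigO h).congr_left fun d => ?_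
  rw [fderiv_partial_eq_half hG hdiag hsymm, hdiag.self_of_nhds]
  simp only [smul_apply]
  module

/-- Absence of quadratic and cubic terms, by expansion around the midpoint `x + d / 2`. -/
theorem symmetric_taylor_one_isBigO_of_flat (hf : ContDiffAt ℝ ∞ f x)
    (hG : ContDiffAt ℝ ∞ G (x, x))
    (hdiag : ∀ᶠ y in 𝓝 x, G (y, y) = f y) (hsymm : ∀ᶠ z in 𝓝 (x, x), G z.swap = G z)
    (hq : ∀ᶠ y in 𝓝 x, ∀ d, fderiv ℝ (fderiv ℝ G) (y, y) (-d, d) (-d, d) = 0)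
    (hf0 : ∀ᶠ y in 𝓝 x, fderiv ℝ (fderiv ℝ f) y = 0) :
    (fun d => G (x, x + d) - f x - (1 / 2 : ℝ) • fderiv ℝ f x d) =O[𝓝 0] fun d => ‖d‖ ^ 4 := by
  have hhalf : Tendsto (fun d : E => (1 / 2 : ℝ) • d) (𝓝 0) (𝓝 0) := by
    simpa using (continuous_const_smul (1 / 2 : ℝ)).tendsto (0 : E)
  have hmid : Tendsto (fun d : E => x + (1 / 2 : ℝ) • d) (𝓝 0) (𝓝 x) := by
    simpa using hhalf.const_add x
  have hpt : Tendsto (fun d : E => (x, x + d)) (𝓝 0) (𝓝 (x, x)) := by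
    have : Continuous fun d : E => (x, x + d) := by fun_prop
    simpa using this.tendsto 0
  have ht : Tendsto (fun d : E => ((x + (1 / 2 : ℝ) • d, x + (1 / 2 : ℝ) • d),
      (-((1 / 2 : ℝ) • d), (1 / 2 : ℝ) • d))) (𝓝 0) (𝓝 ((x, x), 0)) := by
    have : Continuous fun d : E => ((x + (1 / 2 : ℝ) • d, x + (1 / 2 : ℝ) • d),
      (-((1 / 2 : ℝ) • d), (1 / 2 : ℝ) • d)) := by fun_prop
    convert this.tendsto 0 using 2
    simp
    rfl
  have hn : ∀ d : E, ‖(1 / 2 : ℝ) • d‖ ≤ ‖d‖ := fun d => by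
    rw [norm_smul]
    norm_num
    linarith [norm_nonneg d]
  have h1 : (fun d : E => (2 : ℝ) • G (x, x + d) - (2 : ℝ) • f (x + (1 / 2 : ℝ) • d)) =O[𝓝 0]
      fun d => ‖d‖ ^ 4 := by
    refine (((second_difference_isBigO_uniform hG).comp_tendsto ht).trans
      (IsBigO.of_bound 1 (Eventually.of_forall fun d => ?_))).congr' ?_ EventuallyEq.rfl
    · simp only [Function.comp_apply, norm_pow, norm_norm, one_mul]
      gcongr
      refine max_le ?_ (hn d)
      rw [norm_neg]
      exact hn d
    · filter_upwards [hmid.eventually hdiag, hmid.eventually hq, hpt.eventually hsymm]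
        with d h1 h2 h3
      have e1 : x + (1 / 2 : ℝ) • d + -((1 / 2 : ℝ) • d) = x := by abel
      have e2 : x + (1 / 2 : ℝ) • d + (1 / 2 : ℝ) • d = x + d := by module
      have e3 : x + (1 / 2 : ℝ) • d - -((1 / 2 : ℝ) • d) = x + d := by module
      have e4 : x + (1 / 2 : ℝ) • d - (1 / 2 : ℝ) • d = x := by abel
      simp only [Function.comp_apply, Prod.mk_add_mk, Prod.mk_sub_mk, e1, e2, e3, e4]
      rw [h1, h2, show G (x + d, x) = G (x, x + d) from h3]
      module
  have h2 := ((taylor_one_isBigO_of_fderiv_fderiv_eq_zero hf hf0).comp_tendsto hhalf).trans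
    (IsBigO.of_bound 1 (Eventually.of_forall fun d => by
      simp only [Function.comp_apply, norm_pow, norm_norm, one_mul]
      gcongr
      exact hn d) : _ =O[𝓝 0] fun d : E => ‖d‖ ^ 4)
  refine ((h1.const_smul_left (1 / 2 : ℝ)).add h2).congr_left fun d => ?_
  simp only [Function.comp_apply, map_smul, Pi.smul_apply]
  module

end Symmetric

/-! ### Derivatives in coordinates and the coefficients `B` -/

variable {V : Space m → ℝ} {U : Set (Space m)} {W : Set (Space m × Space m)}
  {g : Space m → Space m → Space m} {x : Space m}

section Coordinates

theorem gradient_apply (V : Space m → ℝ) (y : Space m) (γ : Fin m) :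
    gradient V y γ = pd V γ y := by
  have : inner ℝ (gradient V y) (EuclideanSpace.single γ (1 : ℝ)) =
      fderiv ℝ V y (EuclideanSpace.single γ 1) := by
    rw [gradient, InnerProductSpace.toDual_symm_apply]
  rw [EuclideanSpace.inner_single_right] at this
  simpa [pd] using this

theorem contDiffAt_gradient {y : Space m} (hV : ContDiffAt ℝ ∞ V y) :
    ContDiffAt ℝ ∞ (gradient V) y :=
  ((InnerProductSpace.toDual ℝ (Space m)).symm.toContinuousLinearEquiv.contDiff.contDiffAt).comp y
    (hV.fderiv_right (m := ∞) (by simp))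

theorem fderiv_single_apply {k : Space m → Space m} {y : Space m} (hk : DifferentiableAt ℝ k y)
    (γ μ : Fin m) : fderiv ℝ k y (EuclideanSpace.single μ 1) γ = pd (fun y => k y γ) μ y := by
  have : HasFDerivAt (fun y => k y γ) _ y :=
    (EuclideanSpace.proj γ : Space m →L[ℝ] ℝ).hasFDerivAt.comp y hk.hasFDerivAt
  rw [pd, this.fderiv]
  rfl

theorem fderiv_fderiv_single_apply {k : Space m → Space m} {y : Space m}
    (hk : ContDiffAt ℝ ∞ k y) (γ μ ν : Fin m) :
    fderiv ℝ (fderiv ℝ k) y (EuclideanSpace.single ν 1) (EuclideanSpace.single μ 1) γ =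
      pd (pd (fun y => k y γ) μ) ν y := by
  have h1 : pd (fun y => k y γ) μ =ᶠ[𝓝 y]
      fun y => fderiv ℝ k y (EuclideanSpace.single μ 1) γ := by
    filter_upwards [(hk.of_le (m := 1) (by exact_mod_cast le_top)).eventually (by simp)] with z hz
    exact (fderiv_single_apply (hz.differentiableAt (by simp)) γ μ).symm
  have hd : HasFDerivAt (fderiv ℝ k) _ y :=
    ((hk.fderiv_right (m := ∞) (by simp)).differentiableAt (by simp)).hasFDerivAt
  have h2 : HasFDerivAt (fun y => fderiv ℝ k y (EuclideanSpace.single μ 1) γ) _ y :=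
    (EuclideanSpace.proj γ : Space m →L[ℝ] ℝ).hasFDerivAt.comp y
      (hd.clm_apply (hasFDerivAt_const (EuclideanSpace.single μ (1 : ℝ)) y))
  rw [pd, h1.fderiv_eq, h2.fderiv]
  simp

theorem bilin_ext {S T : Space m →L[ℝ] Space m →L[ℝ] Space m}
    (h : ∀ γ μ ν : Fin m, S (EuclideanSpace.single ν 1) (EuclideanSpace.single μ 1) γ =
      T (EuclideanSpace.single ν 1) (EuclideanSpace.single μ 1) γ) : S = T := by
  refine ContinuousLinearMap.coe_injective ((EuclideanSpace.basisFun (Fin m) ℝ).toBasis.ext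
    fun ν => ContinuousLinearMap.coe_injective ((EuclideanSpace.basisFun (Fin m) ℝ).toBasis.ext
      fun μ => ?_))
  ext γ
  simpa using h γ μ ν

theorem bilin_eq_of_forall_diag {E F : Type*} [NormedAddCommGroup E] [NormedSpace ℝ E]
    [NormedAddCommGroup F] [NormedSpace ℝ F] {S T : E →L[ℝ] E →L[ℝ] F}
    (hS : ∀ u v, S u v = S v u) (hT : ∀ u v, T u v = T v u) (h : ∀ u, S u u = T u u) : S = T := by
  ext u v
  have h1 := h (u + v)
  simp only [map_add, add_apply, h u, h v, hS v u, hT v u] at h1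
  have h2 : (2 : ℝ) • S u v = (2 : ℝ) • T u v := by
    rw [two_smul, two_smul]
    have : ∀ a b c d : F, a + c + (c + b) = a + d + (d + b) → c + c = d + d := fun a b c d h => by
      have h' : (a + b) + (c + c) = (a + b) + (d + d) := by
        calc _ = a + c + (c + b) := by abel
          _ = _ := h
          _ = _ := by abel
      exact add_left_cancel h'
    exact this _ _ _ _ h1
  exact smul_right_injective F (two_ne_zero (α := ℝ)) h2

theorem isSymmSndFDerivAt_of_contDiffAt {E F : Type*} [NormedAddCommGroup E] [NormedSpace ℝ E]
    [NormedAddCommGroup F] [NormedSpace ℝ F] {f : E → F} {y : E} (hf : ContDiffAt ℝ ∞ f y) :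
    IsSymmSndFDerivAt ℝ f y :=
  hf.isSymmSndFDerivAt (by
    rw [minSmoothness_of_isRCLikeNormedField]
    exact WithTop.coe_le_coe.2 (le_top : (2 : ℕ∞) ≤ ⊤))

theorem fderiv_gradient_eq (hV : ContDiffAt ℝ ∞ V x) : fderiv ℝ (gradient V) x = hessCLM V x := by
  refine ContinuousLinearMap.coe_injective
    ((EuclideanSpace.basisFun (Fin m) ℝ).toBasis.ext fun μ => ?_)
  ext γ
  have h := fderiv_single_apply ((contDiffAt_gradient hV).differentiableAt (by simp)) γ μ
  simp only [gradient_apply] at h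
  simpa [hessCLM, hess] using h

theorem hess_isHermitian (hV : ContDiffAt ℝ ∞ V x) : (hess V x).IsHermitian := by
  have hd : HasFDerivAt (fderiv ℝ V) _ x :=
    ((hV.fderiv_right (m := ∞) (by simp)).differentiableAt (by simp)).hasFDerivAt
  have key : ∀ γ μ, hess V x γ μ =
      fderiv ℝ (fderiv ℝ V) x (EuclideanSpace.single μ 1) (EuclideanSpace.single γ 1) :=
    fun γ μ => by
      have h2 : HasFDerivAt (pd V γ) _ x :=
        hd.clm_apply (hasFDerivAt_const (EuclideanSpace.single γ (1 : ℝ)) x)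
      rw [hess, Matrix.of_apply, pd, h2.fderiv]
      simp
  ext γ μ
  rw [Matrix.conjTranspose_apply, star_trivial, key, key]
  exact (isSymmSndFDerivAt_of_contDiffAt hV).eq _ _

end Coordinates

theorem IsSymmetricDiscreteGradient.contDiffAt_diag (hg : IsSymmetricDiscreteGradient V U W g)
    (hx : x ∈ U) : ContDiffAt ℝ ∞ (fun z : Space m × Space m => g z.1 z.2) (x, x) :=
  hg.smooth.contDiffAt (hg.isOpen.mem_nhds (hg.diag_mem x hx))

theorem IsSymmetricDiscreteGradient.contDiffAt_right (hg : IsSymmetricDiscreteGradient V U W g)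
    (hx : x ∈ U) : ContDiffAt ℝ ∞ (g x) x :=
  ContDiffAt.comp x (g := fun z : Space m × Space m => g z.1 z.2) (hg.contDiffAt_diag hx)
    (f := fun y => (x, y)) (by fun_prop)

theorem IsSymmetricDiscreteGradient.diag_eq (hg : IsSymmetricDiscreteGradient V U W g)
    (hx : x ∈ U) : g x x = gradient V x :=
  tendsto_nhds_unique (hg.contDiffAt_diag hx).continuousAt (hg.tendsto x hx)

theorem IsSymmetricDiscreteGradient.eventually_diag_eq
    (hg : IsSymmetricDiscreteGradient V U W g) (hU : IsOpen U) (hx : x ∈ U) :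
    ∀ᶠ y in 𝓝 x, g y y = gradient V y :=
  (hU.eventually_mem hx).mono fun _ hy => hg.diag_eq hy

theorem IsSymmetricDiscreteGradient.eventually_swap_eq
    (hg : IsSymmetricDiscreteGradient V U W g) (hx : x ∈ U) :
    ∀ᶠ z in 𝓝 (x, x), (fun z : Space m × Space m => g z.1 z.2) z.swap = g z.1 z.2 :=
  (hg.isOpen.eventually_mem (hg.diag_mem x hx)).mono
    fun z hz => (hg.symm z.1 z.2 hz).symm

/-- The second derivative of `∇V` at `x`, the bilinear map with coefficients `V,_{γμν}(x)`. -/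
noncomputable def gradSecond (V : Space m → ℝ) (x : Space m) :
    Space m →L[ℝ] Space m →L[ℝ] Space m :=
  fderiv ℝ (fderiv ℝ (gradient V)) x

/-- The bilinear map with coefficients `B_{γμν}(x)`. -/
noncomputable def bilinB (g : Space m → Space m → Space m) (x : Space m) :
    Space m →L[ℝ] Space m →L[ℝ] Space m :=
  (3 : ℝ) • fderiv ℝ (fderiv ℝ (g x)) x

theorem gradSecond_single (hV : ContDiffAt ℝ ∞ V x) (γ μ ν : Fin m) :
    gradSecond V x (EuclideanSpace.single ν 1) (EuclideanSpace.single μ 1) γ = third V γ μ ν x := by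
  rw [gradSecond, fderiv_fderiv_single_apply (contDiffAt_gradient hV)]
  simp only [gradient_apply]
  rfl

theorem bilinB_single (hg : ContDiffAt ℝ ∞ (g x) x) (γ μ ν : Fin m) :
    bilinB g x (EuclideanSpace.single ν 1) (EuclideanSpace.single μ 1) γ = coeffB g γ μ ν x := by
  simp [bilinB, coeffB, fderiv_fderiv_single_apply hg]

theorem bilinB_eq_gradSecond_iff (hg : ContDiffAt ℝ ∞ (g x) x) (hV : ContDiffAt ℝ ∞ V x) :
    bilinB g x = gradSecond V x ↔ ∀ γ μ ν : Fin m, coeffB g γ μ ν x = third V γ μ ν x := by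
  refine ⟨fun h γ μ ν => ?_, fun h => bilin_ext fun γ μ ν => ?_⟩
  · rw [← bilinB_single hg, h, gradSecond_single hV]
  · rw [bilinB_single hg, h, gradSecond_single hV]

theorem gradSecond_eq_zero_iff (hV : ContDiffAt ℝ ∞ V x) :
    gradSecond V x = 0 ↔ ∀ γ μ ν : Fin m, third V γ μ ν x = 0 := by
  refine ⟨fun h γ μ ν => ?_, fun h => bilin_ext fun γ μ ν => ?_⟩
  · rw [← gradSecond_single hV, h]
    rfl
  · rw [gradSecond_single hV, h]
    rfl

theorem gradSecond_comm (hV : ContDiffAt ℝ ∞ V x) (u v : Space m) :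
    gradSecond V x u v = gradSecond V x v u :=
  (isSymmSndFDerivAt_of_contDiffAt (contDiffAt_gradient hV)).eq u v

theorem bilinB_comm (hg : ContDiffAt ℝ ∞ (g x) x) (u v : Space m) :
    bilinB g x u v = bilinB g x v u :=
  congrArg ((3 : ℝ) • ·) ((isSymmSndFDerivAt_of_contDiffAt hg).eq u v)

/-! ### The local error -/

section LocalError

variable {p : Space m} {ε : ℝ} {ξ η X P : ℝ → Space m}

theorem norm_pow_isBigO_comp {l : Filter ℝ} {F : Type*} [NormedAddCommGroup F] {R : Space m → F}
    {Δ : ℝ → Space m} {k : ℕ} (hR : R =O[𝓝 0] fun d => ‖d‖ ^ k) (hl : l ≤ 𝓝 0)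
    (hΔ : Δ =O[l] fun h => h ^ 1) : (fun h => R (Δ h)) =O[l] fun h => h ^ k := by
  have h0 : Tendsto Δ l (𝓝 0) := hΔ.trans_tendsto
    (((continuous_pow 1).tendsto' 0 0 (by simp)).mono_left hl)
  exact (hR.comp_tendsto h0).trans ((hΔ.norm_left.pow k).congr_right fun h => by rw [pow_one])

theorem tendsto_deltaCLM (hH : (hess V x).IsHermitian) :
    Tendsto (fun h => deltaCLM V h x) (𝓝[>] 0) (𝓝 0) :=
  (isBigO_one_of_delta_expansion nhdsWithin_le_nhds
    ((deltaCLM_isBigO hH).mono nhdsWithin_le_nhds)).trans_tendsto 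
      (((continuous_pow 1).tendsto' 0 0 (by simp)).mono_left nhdsWithin_le_nhds)

theorem IsExactSolution.eventually (hex : IsExactSolution V U x p ε ξ η) (hε : 0 < ε) :
    ∀ᶠ t in 𝓝 0, HasDerivAt ξ (η t) t ∧ HasDerivAt η (-gradient V (ξ t)) t := by
  filter_upwards [Ioo_mem_nhds (neg_lt_zero.2 hε) hε] with t ht
  exact (hex.2.2 t ht).2

theorem IsExactSolution.position_isBigO (hex : IsExactSolution V U x p ε ξ η) (hε : 0 < ε) :
    (fun t => ξ t - x) =O[𝓝 0] fun t => t ^ 1 := by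
  simpa [hex.1] using (hex.eventually hε).self_of_nhds.1.isBigO_sub

/-- The leading terms of the local error. -/
theorem local_error_isBigO (hU : IsOpen U) (hV : ContDiffOn ℝ ∞ V U)
    (hg : IsSymmetricDiscreteGradient V U W g) (hx : x ∈ U) (hε : 0 < ε)
    (hex : IsExactSolution V U x p ε ξ η)
    (hstep : ∀ᶠ h in 𝓝[>] 0, IsStep V W g h x p (X h) (P h))
    (hΔ : (fun h => X h - x) =O[𝓝[>] 0] fun h => h ^ 1) :
    ((fun h => X h - ξ h - (h ^ 4 / 24) • (gradSecond V x p p - (2 : ℝ) • bilinB g x p p))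
      =O[𝓝[>] 0] fun h => h ^ 5) ∧
    ((fun h => P h - η h - (h ^ 3 / 6) • (gradSecond V x p p - bilinB g x p p))
      =O[𝓝[>] 0] fun h => h ^ 4) := by
  have hVx : ContDiffAt ℝ ∞ V x := hV.contDiffAt (hU.mem_nhds hx)
  have hl : 𝓝[>] (0 : ℝ) ≤ 𝓝 0 := nhdsWithin_le_nhds
  obtain ⟨n1, n2⟩ := numerical_expansion (a := gradient V x) (G := fun h => g x (X h)) hl
    (bilinB g x) ((deltaCLM_isBigO (hess_isHermitian hVx)).mono hl)
    (hstep.mono fun h hh => (isStep_iff.1 hh).2.2.1)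
    (hstep.mono fun h hh => (isStep_iff.1 hh).2.2.2) hΔ (by
      have := norm_pow_isBigO_comp (symmetric_taylor_two_isBigO (hg.contDiffAt_diag hx)
        (hg.eventually_diag_eq hU hx) (hg.eventually_swap_eq hx)) hl hΔ
      simpa [fderiv_gradient_eq hVx, bilinB] using this)
  obtain ⟨e1, e2⟩ := exact_expansion (a := gradient V x) (Q := hessCLM V x)
    (F := fun t => gradient V (ξ t)) (gradSecond V x)
    hex.1 hex.2.1 ((hex.eventually hε).mono fun t ht => ht.1)
    ((hex.eventually hε).mono fun t ht => ht.2) (by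
      have := norm_pow_isBigO_comp (taylor_two_isBigO (contDiffAt_gradient hVx)) le_rfl
        (hex.position_isBigO hε)
      simpa [fderiv_gradient_eq hVx, gradSecond] using this)
  constructor
  · refine (n1.sub (e1.mono hl)).congr_left fun h => ?_
    module
  · refine (n2.sub (e2.mono hl)).congr_left fun h => ?_
    module

/-- If `B = 0` and `V,_{γμν} = 0` throughout `U`, the local error is `O(h⁵)`. Vanishing at `x` alone
would not exclude terms of fourth order in the momentum. -/
theorem local_error_isBigO_of_flat (hU : IsOpen U) (hV : ContDiffOn ℝ ∞ V U)
    (hg : IsSymmetricDiscreteGradient V U W g) (hS : ∀ y ∈ U, gradSecond V y = 0)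
    (hB : ∀ y ∈ U, bilinB g y = 0) (hx : x ∈ U) (hε : 0 < ε)
    (hex : IsExactSolution V U x p ε ξ η)
    (hstep : ∀ᶠ h in 𝓝[>] 0, IsStep V W g h x p (X h) (P h))
    (hΔ : (fun h => X h - x) =O[𝓝[>] 0] fun h => h ^ 1) :
    ((fun h => X h - ξ h) =O[𝓝[>] 0] fun h => h ^ 5) ∧
    ((fun h => P h - η h) =O[𝓝[>] 0] fun h => h ^ 5) := by
  have hVx : ContDiffAt ℝ ∞ V x := hV.contDiffAt (hU.mem_nhds hx)
  have hl : 𝓝[>] (0 : ℝ) ≤ 𝓝 0 := nhdsWithin_le_nhds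
  have hS' : ∀ᶠ y in 𝓝 x, fderiv ℝ (fderiv ℝ (gradient V)) y = 0 :=
    (hU.eventually_mem hx).mono hS
  have hq : ∀ᶠ y in 𝓝 x, ∀ d, fderiv ℝ (fderiv ℝ fun z : Space m × Space m => g z.1 z.2) (y, y)
      (-d, d) (-d, d) = 0 := by
    filter_upwards [hU.mem_nhds hx] with y hy d
    rw [fderiv_fderiv_antidiag (hg.contDiffAt_diag hy) (hg.eventually_diag_eq hU hy)
      (hg.eventually_swap_eq hy)]
    have h1 : fderiv ℝ (fderiv ℝ (g y)) y = 0 :=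
      (smul_eq_zero.1 (hB y hy)).resolve_left (by norm_num)
    have h2 : fderiv ℝ (fderiv ℝ (gradient V)) y = 0 := hS y hy
    simp [h1, h2]
  refine ⟨?_, ?_⟩
  · simpa [hS x hx, hB x hx] using (local_error_isBigO hU hV hg hx hε hex hstep hΔ).1
  have n := numerical_expansion_of_flat (a := gradient V x) (G := fun h => g x (X h)) hl
    ((deltaCLM_isBigO (hess_isHermitian hVx)).mono hl)
    (hstep.mono fun h hh => (isStep_iff.1 hh).2.2.1)
    (hstep.mono fun h hh => (isStep_iff.1 hh).2.2.2) hΔ (by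
      have := norm_pow_isBigO_comp (symmetric_taylor_one_isBigO_of_flat (contDiffAt_gradient hVx)
        (hg.contDiffAt_diag hx) (hg.eventually_diag_eq hU hx) (hg.eventually_swap_eq hx) hq hS')
        hl hΔ
      simpa [fderiv_gradient_eq hVx] using this)
  have e := exact_expansion_of_flat (a := gradient V x) (Q := hessCLM V x)
    (F := fun t => gradient V (ξ t))
    hex.1 hex.2.1 ((hex.eventually hε).mono fun t ht => ht.1)
    ((hex.eventually hε).mono fun t ht => ht.2) (by
      have := norm_pow_isBigO_comp (taylor_one_isBigO_of_fderiv_fderiv_eq_zero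
        (contDiffAt_gradient hVx) hS') le_rfl (hex.position_isBigO hε)
      simpa [fderiv_gradient_eq hVx] using this)
  refine (n.sub (e.mono hl)).congr_left fun h => ?_
  module

end LocalError

/-! ### Order of the scheme -/

/-- The order follows from an asymptotic bound of the local error along every family of numerical
solutions that starts at `x` with displacement `O(h)`. -/
theorem hasOrderAtLeast_of_isBigO (hU : IsOpen U) (hV : ContDiffOn ℝ ∞ V U)
    (hg : IsSymmetricDiscreteGradient V U W g) (r : ℕ)
    (H : ∀ x ∈ U, ∀ p : Space m, ∀ (ε : ℝ) (ξ η X P : ℝ → Space m), 0 < ε →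
      IsExactSolution V U x p ε ξ η → (∀ᶠ h in 𝓝[>] 0, IsStep V W g h x p (X h) (P h)) →
      ((fun h => X h - x) =O[𝓝[>] 0] fun h => h ^ 1) →
      ((fun h => X h - ξ h) =O[𝓝[>] 0] fun h => h ^ (r + 1)) ∧
      ((fun h => P h - η h) =O[𝓝[>] 0] fun h => h ^ (r + 1))) :
    HasOrderAtLeast V U W g r := by
  intro x hx p
  have hVx : ContDiffAt ℝ ∞ V x := hV.contDiffAt (hU.mem_nhds hx)
  have hH := hess_isHermitian hVx
  obtain ⟨ε, hε, ξ, η, hξ0, hη0, hsol⟩ := exists_hamiltonian_solution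
    ((contDiffAt_gradient hVx).of_le (m := 1) (by exact_mod_cast le_top)) p (hU.mem_nhds hx)
  have hex : IsExactSolution V U x p ε ξ η := ⟨hξ0, hη0, hsol⟩
  have hWx : {y | (x, y) ∈ W} ∈ 𝓝 x :=
    (Continuous.prodMk_right x).continuousAt (hg.isOpen.mem_nhds (hg.diag_mem x hx))
  obtain ⟨ρ, hρ, hsub, huniq⟩ := exists_ball_existsUnique_implicit_step
    ((hg.contDiffAt_right hx).of_le (m := 1) (by exact_mod_cast le_top)) p hWx
    (tendsto_deltaCLM hH)
  have huniq' : ∀ᶠ h in 𝓝[>] 0, ∃! z : Space m × Space m, z ∈ Metric.ball (x, p) ρ ∧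
      IsStep V W g h x p z.1 z.2 := by
    filter_upwards [huniq, eventually_isUnit_deltaLEX hH] with h hh hu
    convert hh using 2 with z
    refine and_congr_right fun hz => ?_
    have hz1 : (x, z.1) ∈ W := hsub (by
      rw [Metric.mem_ball, Prod.dist_eq] at hz
      exact (le_max_left _ _).trans_lt hz)
    rw [isStep_iff]
    exact ⟨fun h' => h'.2.2, fun h' => ⟨hz1, hu, h'⟩⟩
  obtain ⟨z, hz⟩ := (huniq'.mono fun h hh => hh.exists).choice
  have hP : (fun h => (z h).2) =O[𝓝[>] 0] fun h => h ^ 0 := by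
    refine IsBigO.of_bound (‖(x, p)‖ + ρ) (hz.mono fun h hh => ?_)
    have h1 : ‖z h - (x, p)‖ < ρ := by simpa [dist_eq_norm] using hh.1
    have h2 := norm_sub_norm_le (z h) (x, p)
    have h3 := norm_snd_le (z h)
    simp only [pow_zero, norm_one, mul_one]
    linarith
  have hΔ : (fun h => (z h).1 - x) =O[𝓝[>] 0] fun h => h ^ 1 :=
    position_isBigO_of_delta_expansion nhdsWithin_le_nhds
      ((deltaCLM_isBigO hH).mono nhdsWithin_le_nhds)
      (hz.mono fun h hh => (isStep_iff.1 hh.2).2.2.1) hP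
  obtain ⟨h1, h2⟩ := H x hx p ε ξ η (fun h => (z h).1) (fun h => (z h).2) hε hex
    (hz.mono fun h hh => hh.2) hΔ
  obtain ⟨C₁, hC₁⟩ := h1.bound
  obtain ⟨C₂, hC₂⟩ := h2.bound
  obtain ⟨ε', hε', hall⟩ := mem_nhdsGT_iff_exists_Ioo_subset.1
    (huniq'.and (hz.and (hC₁.and hC₂)))
  refine ⟨min ε ε', lt_min hε hε', ρ, hρ, max C₁ C₂, ξ, η, ⟨hξ0, hη0, fun t ht => hsol t
    ⟨by linarith [ht.1, min_le_left ε ε'], ht.2.trans_le (min_le_left _ _)⟩⟩, fun h hh => ?_⟩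
  obtain ⟨hu, hzh, hb₁, hb₂⟩ := hall ⟨hh.1, hh.2.trans_le (min_le_right _ _)⟩
  refine ⟨hu, fun w hw hws => ?_⟩
  obtain rfl : w = z h := hu.unique ⟨hw, hws⟩ hzh
  have hpos : 0 ≤ h ^ (r + 1) := pow_nonneg (le_of_lt hh.1) _
  rw [Real.norm_of_nonneg hpos] at hb₁ hb₂
  exact ⟨hb₁.trans (by gcongr; exact le_max_left _ _),
    hb₂.trans (by gcongr; exact le_max_right _ _)⟩

/-- A family of numerical solutions with the local error that the order promises. The displacement
is `O(h)` because the exact solution has this property; the neighbourhood in which the scheme is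
uniquely solvable need not be small. -/
theorem HasOrderAtLeast.exists_isBigO {r : ℕ} (H : HasOrderAtLeast V U W g r) (hx : x ∈ U)
    (p : Space m) : ∃ (ε : ℝ) (ξ η X P : ℝ → Space m), 0 < ε ∧
      IsExactSolution V U x p ε ξ η ∧ (∀ᶠ h in 𝓝[>] 0, IsStep V W g h x p (X h) (P h)) ∧
      ((fun h => X h - x) =O[𝓝[>] 0] fun h => h ^ 1) ∧
      ((fun h => X h - ξ h) =O[𝓝[>] 0] fun h => h ^ (r + 1)) ∧
      ((fun h => P h - η h) =O[𝓝[>] 0] fun h => h ^ (r + 1)) := by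
  obtain ⟨ε, hε, ρ, hρ, K, ξ, η, hex, hall⟩ := H x hx p
  have hev : ∀ᶠ h in 𝓝[>] (0 : ℝ), h ∈ Ioo 0 ε := Ioo_mem_nhdsGT hε
  obtain ⟨z, hz⟩ := (hev.mono fun h hh => (hall h hh).1.exists).choice
  have hbd : ∀ᶠ h in 𝓝[>] (0 : ℝ), ‖(z h).1 - ξ h‖ ≤ K * ‖h ^ (r + 1)‖ ∧
      ‖(z h).2 - η h‖ ≤ K * ‖h ^ (r + 1)‖ := by
    filter_upwards [hev, hz] with h hh hzh
    rw [Real.norm_of_nonneg (pow_nonneg (le_of_lt hh.1) _)]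
    exact (hall h hh).2 _ hzh.1 hzh.2
  have h1 : (fun h => (z h).1 - ξ h) =O[𝓝[>] 0] fun h => h ^ (r + 1) :=
    IsBigO.of_bound K (hbd.mono fun h hh => hh.1)
  refine ⟨ε, ξ, η, fun h => (z h).1, fun h => (z h).2, hε, hex, hz.mono fun h hh => hh.2, ?_, h1,
    IsBigO.of_bound K (hbd.mono fun h hh => hh.2)⟩
  exact ((isBigO_pow_mono nhdsWithin_le_nhds h1 (by omega : 1 ≤ r + 1)).add
    ((hex.position_isBigO hε).mono nhdsWithin_le_nhds)).congr_left fun h => sub_add_sub_cancel _ _ _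

theorem eq_zero_of_pow_smul_isBigO {E : Type*} [NormedAddCommGroup E] [NormedSpace ℝ E] {c : ℝ}
    (hc : c ≠ 0) {k : ℕ} {v : E}
    (h : (fun h : ℝ => (h ^ k / c) • v) =O[𝓝[>] 0] fun h => h ^ (k + 1)) : v = 0 := by
  have h1 : (fun h : ℝ => (c * (h ^ k)⁻¹) • (h ^ k / c) • v) =O[𝓝[>] 0]
      fun h => (c * (h ^ k)⁻¹) * h ^ (k + 1) := 
    ((isBigO_refl (fun h : ℝ => c * (h ^ k)⁻¹) _).smul h).congr_right fun h => smul_eq_mul ..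
  have h2 : (fun _ : ℝ => v) =O[𝓝[>] 0] fun h => c * h := by
    refine h1.congr' ?_ ?_
    · filter_upwards [self_mem_nhdsWithin] with h (hh : 0 < h)
      rw [smul_smul]
      have : c * (h ^ k)⁻¹ * (h ^ k / c) = 1 := by
        field_simp
      rw [this, one_smul]
    · filter_upwards [self_mem_nhdsWithin] with h (hh : 0 < h)
      rw [pow_succ]
      field_simp
  have h3 : Tendsto (fun h : ℝ => c * h) (𝓝[>] 0) (𝓝 0) := by
    have : Continuous fun h : ℝ => c * h := by fun_prop
    simpa using (this.tendsto 0).mono_left nhdsWithin_le_nhds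
  exact tendsto_nhds_unique tendsto_const_nhds (h2.trans_tendsto h3)

theorem bilinB_eq_gradSecond_of_hasOrderAtLeast (hU : IsOpen U) (hV : ContDiffOn ℝ ∞ V U)
    (hg : IsSymmetricDiscreteGradient V U W g) {r : ℕ} (hr : 3 ≤ r)
    (H : HasOrderAtLeast V U W g r) (hx : x ∈ U) : bilinB g x = gradSecond V x := by
  have hVx : ContDiffAt ℝ ∞ V x := hV.contDiffAt (hU.mem_nhds hx)
  refine bilin_eq_of_forall_diag (bilinB_comm (hg.contDiffAt_right hx)) (gradSecond_comm hVx)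
    fun p => ?_
  obtain ⟨ε, ξ, η, X, P, hε, hex, hstep, hΔ, -, h2⟩ := H.exists_isBigO hx p
  have h3 := (local_error_isBigO hU hV hg hx hε hex hstep hΔ).2
  have h4 := (isBigO_pow_mono nhdsWithin_le_nhds h2 (by omega : 4 ≤ r + 1)).sub h3
  simp only [sub_sub_cancel] at h4
  exact (sub_eq_zero.1 (eq_zero_of_pow_smul_isBigO (by norm_num) h4)).symm

theorem gradSecond_eq_zero_of_hasOrderAtLeast (hU : IsOpen U) (hV : ContDiffOn ℝ ∞ V U)
    (hg : IsSymmetricDiscreteGradient V U W g) (H : HasOrderAtLeast V U W g 4) (hx : x ∈ U) :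
    gradSecond V x = 0 := by
  have hVx : ContDiffAt ℝ ∞ V x := hV.contDiffAt (hU.mem_nhds hx)
  have hBS := bilinB_eq_gradSecond_of_hasOrderAtLeast hU hV hg (by norm_num) H hx
  refine bilin_eq_of_forall_diag (gradSecond_comm hVx) (fun _ _ => rfl) fun p => ?_
  obtain ⟨ε, ξ, η, X, P, hε, hex, hstep, hΔ, h1, -⟩ := H.exists_isBigO hx p
  have h4 := h1.sub (local_error_isBigO hU hV hg hx hε hex hstep hΔ).1
  simp only [sub_sub_cancel, hBS] at h4
  have h5 := eq_zero_of_pow_smul_isBigO (by norm_num) h4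
  rw [two_smul, sub_add_cancel_left, neg_eq_zero] at h5
  simpa using h5

end LEXScheme

theorem theorem4p5 {m : ℕ} (V : LEXScheme.Space m → ℝ) (U : Set (LEXScheme.Space m))
    (W : Set (LEXScheme.Space m × LEXScheme.Space m))
    (g : LEXScheme.Space m → LEXScheme.Space m → LEXScheme.Space m)
    (hU : IsOpen U) (hV : ContDiffOn ℝ ∞ V U)
    (hg : LEXScheme.IsSymmetricDiscreteGradient V U W g) :
    LEXScheme.HasOrderAtLeast V U W g 2 ∧
    (LEXScheme.HasOrderAtLeast V U W g 3 ↔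
      ∀ x ∈ U, ∀ γ μ ν : Fin m, LEXScheme.coeffB g γ μ ν x = LEXScheme.third V γ μ ν x) ∧
    (LEXScheme.HasOrderAtLeast V U W g 4 ↔
      ∀ x ∈ U, ∀ γ μ ν : Fin m, LEXScheme.coeffB g γ μ ν x = LEXScheme.third V γ μ ν x ∧
        LEXScheme.third V γ μ ν x = 0) := by
  have hVx : ∀ x ∈ U, ContDiffAt ℝ ∞ V x := fun x hx => hV.contDiffAt (hU.mem_nhds hx)
  have hBS : ∀ x ∈ U, LEXScheme.bilinB g x = LEXScheme.gradSecond V x ↔ _ := fun x hx =>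
    LEXScheme.bilinB_eq_gradSecond_iff (hg.contDiffAt_right hx) (hVx x hx)
  have hl : 𝓝[>] (0 : ℝ) ≤ 𝓝 0 := nhdsWithin_le_nhds
  refine ⟨?_, ⟨fun H x hx => ?_, fun H => ?_⟩, ⟨fun H x hx γ μ ν => ?_, fun H => ?_⟩⟩
  · refine LEXScheme.hasOrderAtLeast_of_isBigO hU hV hg 2
      fun x hx p ε ξ η X P hε hex hstep hΔ => ?_
    obtain ⟨h1, h2⟩ := LEXScheme.local_error_isBigO hU hV hg hx hε hex hstep hΔ
    constructor
    · refine ((LEXScheme.isBigO_pow_mono hl h1 (by norm_num : 3 ≤ 5)).add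
        (LEXScheme.isBigO_pow_mono hl (LEXScheme.isBigO_mul_pow_smul (1 / 24) 4
          (LEXScheme.isBigO_const_pow_zero (LEXScheme.gradSecond V x p p -
            (2 : ℝ) • LEXScheme.bilinB g x p p))) (by norm_num : 3 ≤ 4 + 0))).congr_left
            fun h => ?_
      module
    · refine ((LEXScheme.isBigO_pow_mono hl h2 (by norm_num : 3 ≤ 4)).add
        (LEXScheme.isBigO_mul_pow_smul (1 / 6) 3
          (LEXScheme.isBigO_const_pow_zero (LEXScheme.gradSecond V x p p -
            LEXScheme.bilinB g x p p)))).congr_left fun h => ?_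
      module
  · exact (hBS x hx).1
      (LEXScheme.bilinB_eq_gradSecond_of_hasOrderAtLeast hU hV hg le_rfl H hx)
  · refine LEXScheme.hasOrderAtLeast_of_isBigO hU hV hg 3
      fun x hx p ε ξ η X P hε hex hstep hΔ => ?_
    obtain ⟨h1, h2⟩ := LEXScheme.local_error_isBigO hU hV hg hx hε hex hstep hΔ
    rw [(hBS x hx).2 (H x hx)] at h1 h2
    constructor
    · refine ((LEXScheme.isBigO_pow_mono hl h1 (by norm_num : 4 ≤ 5)).add
        (LEXScheme.isBigO_mul_pow_smul (1 / 24) 4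
          (LEXScheme.isBigO_const_pow_zero (LEXScheme.gradSecond V x p p -
            (2 : ℝ) • LEXScheme.gradSecond V x p p)))).congr_left fun h => ?_
      module
    · simpa using h2
  · exact ⟨(hBS x hx).1 (LEXScheme.bilinB_eq_gradSecond_of_hasOrderAtLeast hU hV hg
      (by norm_num) H hx) γ μ ν, (LEXScheme.gradSecond_eq_zero_iff (hVx x hx)).1
        (LEXScheme.gradSecond_eq_zero_of_hasOrderAtLeast hU hV hg H hx) γ μ ν⟩
  · have hS : ∀ y ∈ U, LEXScheme.gradSecond V y = 0 := fun y hy =>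
      (LEXScheme.gradSecond_eq_zero_iff (hVx y hy)).2 fun γ μ ν => (H y hy γ μ ν).2
    exact LEXScheme.hasOrderAtLeast_of_isBigO hU hV hg 4
      fun x hx p ε ξ η X P hε hex hstep hΔ =>
        LEXScheme.local_error_isBigO_of_flat hU hV hg hS
          (fun y hy => ((hBS y hy).2 fun γ μ ν => (H y hy γ μ ν).1).trans (hS y hy))
          hx hε hex hstep hΔ
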